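/- **Theorem 1.** There are $I\ge 1$ arms. Let $Y_{i,t}$ be the reward offered by arm $i$ in round $t\ge 1$. For each $i$ the rewards $Y_{i,1},Y_{i,2},\dots$ are i.i.d. with mean $\mu_i$ and finite variance, the reward vectors $(Y_{i,t})_{i\le I}$ of different rounds are independent (the arms may be dependent on one another), and arm $1$ is the unique best one: $\Delta_i:=\mu_1-\mu_i>0$ for all $i\ge 2$. In round $t$ the agent plays an arm $A_t$ and earns $Y_{A_t,t}$; let $\mathcal H_t=\sigma(A_1,Y_{A_1,1},\dots,A_t,Y_{A_t,t})$. Rewards are revealed only at batch end points $0=T_0<T_1<T_2<\cdots$ (finite integers), where $T_{j+1}$ is chosen by an adversary at time $T_j$ as a function of the history $\mathcal H_{T_j}$. The agent uses Thompson sampling with Gaussian pseudo-priors: with $N_i(n)=\sum_{t\le n}\mathbf 1_{\{A_t=i\}}$, $$\hat\mu_i(n)=\frac{\sum_{t\le n}\mathbf 1_{\{A_t=i\}}Y_{i,t}}{1+N_i(n)},\qquad \hat\sigma_i^2(n)=\frac1{1+N_i(n)},$$ in every round $t$ with $T_j<t\le T_{j+1}$ she draws, conditionally on everything that happened before round $t$,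 independent samples $\theta_i(t)\sim\mathcal N(\hat\mu_i(T_j),\hat\sigma_i^2(T_j))$, $i=1,\dots,I$, and plays an arm $A_t\in\arg\max_i\theta_i(t)$. The reward vector of round $t$ is independent of all that happened before round $t$ together with the samples and the action of round $t$. Assume that almost surely $$\limsup_{j\to\infty}\log_{T_j}(T_{j+1}-T_j)<1 .$$ Then the cumulative random regret $R(T)=\sum_{t=1}^T (Y_{1,t}-Y_{A_t,t})$ satisfies, almost surely, $$\lim_{T\to\infty}\frac{R(T)}{\log T}=\sum_{i=2}^I\frac{2}{\Delta_i}.$$ -/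

import Mathlib

open MeasureTheory ProbabilityTheory Filter Topology
open scoped NNReal

/-! Rounds are numbered `0, 1, 2, …`, and "time `n`" means that the `n` rounds `0, …, n - 1` have
been played. Arms are the elements of `Fin I`. `Y i t` is the reward that arm `i` offers in round
`t`, `A t` is the arm played in round `t`, `θ i t` is the index sampled for arm `i` in round `t`,
and `T j` is the end of the `j`-th batch: batch number `j + 1` consists of the rounds `t` with
`T j ≤ t < T (j + 1)`. -/

namespace BatchedBandit

noncomputable section

/-- The number `N_i(n)` of pulls of arm `i` up to time `n`. -/
def pullCount {Ω : Type*} {I : ℕ} (A : ℕ → Ω → Fin I) (i : Fin I) (n : ℕ) (ω : Ω) : ℕ :=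
  ((Finset.range n).filter (fun s => A s ω = i)).card

/-- The pseudo-posterior mean of arm `i` at time `n`. -/
def postMean {Ω : Type*} {I : ℕ} (Y : Fin I → ℕ → Ω → ℝ) (A : ℕ → Ω → Fin I)
    (i : Fin I) (n : ℕ) (ω : Ω) : ℝ :=
  (∑ s ∈ Finset.range n, if A s ω = i then Y i s ω else 0) / (1 + (pullCount A i n ω : ℝ))

/-- The pseudo-posterior variance of arm `i` at time `n`. -/
def postVar {Ω : Type*} {I : ℕ} (A : ℕ → Ω → Fin I) (i : Fin I) (n : ℕ) (ω : Ω) : ℝ≥0 :=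
  1 / (1 + (pullCount A i n ω : ℝ≥0))

/-- The observable history at time `t`: the σ-algebra generated by the arms played and the rewards
received in the rounds before `t`. -/
@[reducible] def history {Ω : Type*} {I : ℕ} (Y : Fin I → ℕ → Ω → ℝ) (A : ℕ → Ω → Fin I) (t : ℕ) :
    MeasurableSpace Ω :=
  MeasurableSpace.comap
    (fun (ω : Ω) (s : Fin t) => ((A s ω, Y (A s ω) s ω) : Fin I × ℝ)) inferInstance

/-- Everything that happened in the rounds before `t`: all rewards (seen or not), all sampled
indices, all arms played. -/
def past {Ω : Type*} {I : ℕ} (Y θ : Fin I → ℕ → Ω → ℝ) (A : ℕ → Ω → Fin I) (t : ℕ) (ω : Ω) :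
    Fin t → (Fin I → ℝ) × (Fin I → ℝ) × Fin I :=
  fun s => (fun i => Y i s ω, fun i => θ i s ω, A s ω)

/-- The number `b` of batches completed at time `t`, i.e. the largest `j` with `T j ≤ t`
(for a strictly increasing sequence of naturals such a `j` is at most `t`). -/
def batchIndex {Ω : Type*} (T : ℕ → Ω → ℕ) (t : ℕ) (ω : Ω) : ℕ :=
  Nat.findGreatest (fun j => T j ω ≤ t) t

/-- The time of the last feedback available to the agent in round `t`. -/
def lastFeedback {Ω : Type*} (T : ℕ → Ω → ℕ) (t : ℕ) (ω : Ω) : ℕ :=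
  T (batchIndex T t ω) ω

/-- The cumulative random regret at time `n`, with respect to the arm `0`. -/
def regret {Ω : Type*} {I : ℕ} [NeZero I] (Y : Fin I → ℕ → Ω → ℝ) (A : ℕ → Ω → Fin I)
    (n : ℕ) (ω : Ω) : ℝ :=
  ∑ t ∈ Finset.range n, (Y 0 t ω - Y (A t ω) t ω)

/-- The rewards of each arm `i` are identically distributed over the rounds, with mean `μ i` and
finite variance. (Independence over the rounds is part of `IsThompsonSampling`; no independence
between the arms is assumed.) -/
structure IsRewardModel {Ω : Type*} [MeasurableSpace Ω] (P : Measure Ω) {I : ℕ}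
    (Y : Fin I → ℕ → Ω → ℝ) (μ : Fin I → ℝ) : Prop where
  measurable : ∀ i t, Measurable (Y i t)
  identDistrib : ∀ i t, IdentDistrib (Y i t) (Y i 0) P P
  memLp : ∀ i, MemLp (Y i 0) 2 P
  mean : ∀ i, ∫ ω, Y i 0 ω ∂P = μ i

/-- An adversarial batch structure `0 = T 0 < T 1 < …`: the next end point `T (j + 1)` is chosen at
time `T j` as a function of the observable history at that time. -/
structure IsAdversarialBatching {Ω : Type*} {I : ℕ}
    (Y : Fin I → ℕ → Ω → ℝ) (A : ℕ → Ω → Fin I) (T : ℕ → Ω → ℕ) : Prop where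
  zero : ∀ ω, T 0 ω = 0
  strictMono : ∀ ω, StrictMono (fun j => T j ω)
  adapted : ∀ j t s, MeasurableSet[history Y A t] {ω | T j ω = t ∧ T (j + 1) ω = s}

/-- Thompson sampling with Gaussian pseudo-priors and batched feedback. In round `t`, given the
whole past, the indices `θ i t` are drawn independently over `i` from the normal distributions with
the pseudo-posterior means and variances at the time of the last feedback, and an arm with the
largest index is played. The vector of rewards of round `t` is independent of the whole past and of
the sampling and the action in round `t`. -/
structure IsThompsonSampling {Ω : Type*} [MeasurableSpace Ω] (P : Measure Ω) {I : ℕ}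
    (Y θ : Fin I → ℕ → Ω → ℝ) (A : ℕ → Ω → Fin I) (T : ℕ → Ω → ℕ) : Prop where
  measurable_index : ∀ i t, Measurable (θ i t)
  measurable_arm : ∀ t, Measurable (A t)
  argmax : ∀ t ω i, θ i t ω ≤ θ (A t ω) t ω
  sample : ∀ t (B : Set (Fin I → ℝ)), MeasurableSet B →
    P⟦(fun ω i => θ i t ω) ⁻¹' B | MeasurableSpace.comap (past Y θ A t) inferInstance⟧ =ᵐ[P]
      fun ω => (Measure.pi (fun i : Fin I => gaussianReal (postMean Y A i (lastFeedback T t ω) ω)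
        (postVar A i (lastFeedback T t ω) ω))).real B
  reward_indep : ∀ t, IndepFun (fun ω i => Y i t ω)
    (fun ω => (past Y θ A t ω, (fun i => θ i t ω : Fin I → ℝ), A t ω)) P

end

end BatchedBandit

/-!
Write `ℱ t` for the past of round `t`, `p i t` for the conditional probability, given `ℱ t`, that
arm `i` is played in round `t`, `N i n` for the number of pulls of arm `i` before time `n`, and
`Δ i = μ 0 - μ i`. The regret is, up to centred rewards that are negligible by a strong law for
adaptively selected rewards, `∑ Δ i * N i n`, so the theorem amounts to
`N i n / log n → 2 / Δ i ^ 2` for every suboptimal arm.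

Two probabilistic facts carry the argument; everything else is done along a fixed trajectory.
* `ae_tendsto_sum_weight`: dividing each centred reward by the running number of pulls yields an
  `L²`-bounded martingale, so that Kronecker's lemma gives consistency of the posterior means of the
  arms that are pulled infinitely often. Only finite variance is used.
* `integral_prod_exp_le_one`: for predictable `V ≥ -1` the product
  `∏ (1 + V t 1_{s t}) exp (- V t P(s t | ℱ t))` has mean at most one, hence is almost surely
  `O(n ^ 2)`. For constant `V` this bounds `N i n` below by half of `∑ p i t`, up to `O(log n)`
  (`ae_sum_condExp_le`). With `V = e ^ K - 1` on the rounds where `p i t` is below a threshold, and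
  `K` arbitrarily large, only `o(log n)` pulls happen in those rounds if the thresholds have bounded
  sum (`ae_card_filter_le_mul_log`). Selecting the rounds by the value of `p i t` makes the weights
  predictable by construction.

Along a trajectory, let `g t` be the time of the last feedback. Every arm is pulled infinitely often
and the best arm linearly often, so Gaussian tails give
`p i t = exp (- (1 + o(1)) (Δ i ^ 2 / 2) N i (g t))`, up to an error `O(t ^ (-2))` in the upper bound.
Lower bound: if `N i n < (1 - δ) (2 / Δ i ^ 2) log n`, then `∑_{t < n} p i t` is at least a power of
`n`, contradicting `ae_sum_condExp_le`. Upper bound: rounds with `p i t ≤ t ^ (-(1 + κ))` contribute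
`o(log n)` pulls. Let `s` be the last other round before `n`. Then
`N i (g s) ≤ (1 + o(1)) (2 / Δ i ^ 2) log n`, and it remains to count the pulls between `g s` and `s`,
inside one batch. Here the growth condition enters: the batch has length at most `(g s) ^ r` with
`r < 1`, whereas by the lower bound on `N i` the probabilities are at most `t ^ (-ρ)` with
`r < ρ < 1`. Over such a window they sum to `O(1)`, so the pulls are again `o(log n)`.
-/

namespace BatchedBandit

/-! ### Gaussian tails -/

theorem gaussianReal_real_Ici_le {m x : ℝ} (v : ℝ≥0) (h : m ≤ x) :
    (gaussianReal m v).real (Set.Ici x) ≤ Real.exp (-(x - m) ^ 2 / (2 * v)) := by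
  rcases eq_or_ne v 0 with rfl | hv
  · simp
  have hv' : (0 : ℝ) < v := by positivity
  have h1 := measure_ge_le_exp_mul_mgf (μ := gaussianReal m v) (X := id) (t := (x - m) / v) x
    (div_nonneg (sub_nonneg.2 h) hv'.le) (integrable_exp_mul_gaussianReal _)
  rw [mgf_id_gaussianReal, ← Real.exp_add] at h1
  refine h1.trans (Real.exp_le_exp.2 (le_of_eq ?_))
  field_simp
  ring

theorem gaussianReal_real_Iic_le {m x : ℝ} (v : ℝ≥0) (h : x ≤ m) :
    (gaussianReal m v).real (Set.Iic x) ≤ Real.exp (-(x - m) ^ 2 / (2 * v)) := by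
  have h1 := gaussianReal_real_Ici_le (m := -m) (x := -x) v (neg_le_neg h)
  rw [← gaussianReal_map_neg, map_measureReal_apply measurable_neg measurableSet_Ici] at h1
  have : (fun x : ℝ => -x) ⁻¹' Set.Ici (-x) = Set.Iic x := by ext; simp
  rw [this] at h1
  refine h1.trans (le_of_eq ?_)
  congr 2
  ring

theorem one_half_le_of_le_exp_neg_one {a : ℝ} (h : 1 - a ≤ Real.exp (-1)) : 1 / 2 ≤ a := by
  have h2 : Real.exp (-1) ≤ 1 / 2 := by
    rw [Real.exp_neg, one_div]
    exact inv_anti₀ (by norm_num) (by linarith [Real.add_one_le_exp (1 : ℝ)])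
  linarith

theorem half_le_gaussianReal_real_Iic {m x : ℝ} {v : ℝ≥0} (hv : v ≠ 0) (h : m ≤ x)
    (h2 : 2 * v ≤ (x - m) ^ 2) : 1 / 2 ≤ (gaussianReal m v).real (Set.Iic x) := by
  have hv' : (0 : ℝ) < v := by positivity
  refine one_half_le_of_le_exp_neg_one ?_
  have h1 : 1 - (gaussianReal m v).real (Set.Iic x) = (gaussianReal m v).real (Set.Iic x)ᶜ := by
    rw [probReal_compl_eq_one_sub measurableSet_Iic]
  rw [h1, Set.compl_Iic]
  refine (measureReal_mono Set.Ioi_subset_Ici_self).trans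
    ((gaussianReal_real_Ici_le v h).trans (Real.exp_le_exp.2 ?_))
  rw [div_le_iff₀ (by positivity)]
  linarith

theorem half_le_gaussianReal_real_Ioi {m x : ℝ} {v : ℝ≥0} (hv : v ≠ 0) (h : x ≤ m)
    (h2 : 2 * v ≤ (x - m) ^ 2) : 1 / 2 ≤ (gaussianReal m v).real (Set.Ioi x) := by
  have hv' : (0 : ℝ) < v := by positivity
  refine one_half_le_of_le_exp_neg_one ?_
  have h1 : 1 - (gaussianReal m v).real (Set.Ioi x) = (gaussianReal m v).real (Set.Ioi x)ᶜ := by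
    rw [probReal_compl_eq_one_sub measurableSet_Ioi]
  rw [h1, Set.compl_Ioi]
  refine (gaussianReal_real_Iic_le v h).trans (Real.exp_le_exp.2 ?_)
  rw [div_le_iff₀ (by positivity)]
  linarith

/-- The lower tail bound: the density on `(m + D, m + D + √v]` is at least its value at the right
end point, and the interval has length `√v`. -/
theorem exp_le_gaussianReal_real_Ioi {m x D : ℝ} {v : ℝ≥0} (hv : v ≠ 0) (hD : 0 ≤ D)
    (h : x - m ≤ D) :
    Real.exp (-(D + √v) ^ 2 / (2 * v)) / 3 ≤ (gaussianReal m v).real (Set.Ioi x) := by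
  have hv' : (0 : ℝ) < v := by positivity
  have hsub : Set.Ioc (m + D) (m + D + √v) ⊆ Set.Ioi x := fun y hy => by
    have := hy.1
    simp only [Set.mem_Ioi]; linarith
  refine le_trans ?_ (measureReal_mono hsub)
  rw [measureReal_def, gaussianReal_apply_eq_integral _ hv, ENNReal.toReal_ofReal
    (integral_nonneg fun y => gaussianPDFReal_nonneg _ _ _)]
  have h1 : ∫ y in Set.Ioc (m + D) (m + D + √v),
      ((√(2 * Real.pi * v))⁻¹ * Real.exp (-(D + √v) ^ 2 / (2 * v)))
      ≤ ∫ y in Set.Ioc (m + D) (m + D + √v), gaussianPDFReal m v y := by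
    refine setIntegral_mono_on (integrableOn_const (by simp))
      (integrable_gaussianPDFReal m v).integrableOn measurableSet_Ioc fun y hy => ?_
    rw [gaussianPDFReal]
    gcongr
    · linarith [hy.1]
    · linarith [hy.2]
  refine le_trans ?_ h1
  rw [setIntegral_const, measureReal_def, Real.volume_Ioc, smul_eq_mul]
  have e1 : m + D + √(v : ℝ) - (m + D) = √v := by ring
  rw [e1, ENNReal.toReal_ofReal (Real.sqrt_nonneg _), Real.sqrt_mul (by positivity)]
  have h3 : √(2 * Real.pi) ≤ 3 := by
    rw [Real.sqrt_le_left (by norm_num)]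
    linarith [Real.pi_lt_four]
  have h4 : 0 < √(v : ℝ) := Real.sqrt_pos.2 hv'
  have h5 : 0 < √(2 * Real.pi) := by positivity
  have : √(v : ℝ) * ((√(2 * Real.pi) * √v)⁻¹ * Real.exp (-(D + √v) ^ 2 / (2 * v)))
      = Real.exp (-(D + √v) ^ 2 / (2 * v)) / √(2 * Real.pi) := by
    field_simp
  rw [this]
  gcongr

/-! ### Exponential supermartingales for adapted events -/

section Exponential

variable {Ω : Type*} {mΩ : MeasurableSpace Ω} {P : Measure Ω} [IsProbabilityMeasure P]

theorem condExp_indicator_one_mem_Icc {m : MeasurableSpace Ω} (hm : m ≤ mΩ) {s : Set Ω}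
    (hs : MeasurableSet[mΩ] s) :
    ∀ᵐ ω ∂P, 0 ≤ (P⟦s | m⟧) ω ∧ (P⟦s | m⟧) ω ≤ 1 := by
  have h0 : 0 ≤ᵐ[P] P⟦s | m⟧ :=
    condExp_nonneg (.of_forall fun ω => Set.indicator_nonneg (fun _ _ => zero_le_one) ω)
  have h1 : P⟦s | m⟧ ≤ᵐ[P] P[fun _ => (1 : ℝ) | m] :=
    condExp_mono ((integrable_const _).indicator hs) (integrable_const _)
      (.of_forall fun ω => Set.indicator_le_self' (fun _ _ => zero_le_one) ω)
  rw [condExp_const hm] at h1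
  filter_upwards [h0, h1] with ω a b using ⟨a, b⟩

/-- The tower property, for a bounded `m`-measurable factor. -/
theorem integral_mul_indicator_eq {m : MeasurableSpace Ω} (hm : m ≤ mΩ) {s : Set Ω}
    (hs : MeasurableSet[mΩ] s) {H : Ω → ℝ} (hH : StronglyMeasurable[m] H) {C : ℝ}
    (hC : ∀ᵐ ω ∂P, ‖H ω‖ ≤ C) :
    ∫ ω, H ω * s.indicator (fun _ => (1 : ℝ)) ω ∂P = ∫ ω, H ω * (P⟦s | m⟧) ω ∂P := by
  have hint : Integrable (s.indicator (fun _ => (1 : ℝ))) P := (integrable_const _).indicator hs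
  have h1 := condExp_stronglyMeasurable_mul_of_bound hm hH hint C hC
  have h2 := integral_condExp hm (μ := P) (f := H * s.indicator (fun _ => (1 : ℝ)))
  rw [integral_congr_ae h1] at h2
  exact h2.symm

/-- The supermartingale `∏ (1 + V t 1_{s t}) exp (- V t P(s t | ℱ t))` has mean at most one. -/
theorem integral_prod_exp_le_one (ℱ : Filtration ℕ mΩ) {s : ℕ → Set Ω}
    (hs : ∀ t, MeasurableSet[ℱ (t + 1)] (s t)) {V : ℕ → Ω → ℝ}
    (hV : ∀ t, StronglyMeasurable[ℱ t] (V t)) {K : ℝ} (hV1 : ∀ t ω, -1 ≤ V t ω)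
    (hVK : ∀ t ω, V t ω ≤ K) (hK : 1 ≤ K) (n : ℕ) :
    let Z : ℕ → Ω → ℝ := fun n ω => ∏ t ∈ Finset.range n,
      ((1 + V t ω * (s t).indicator (fun _ => (1 : ℝ)) ω) *
        Real.exp (-(V t ω * (P⟦s t | ℱ t⟧) ω)))
    StronglyMeasurable[ℱ n] (Z n) ∧ (∀ ω, 0 ≤ Z n ω) ∧
      (∃ C, ∀ᵐ ω ∂P, ‖Z n ω‖ ≤ C) ∧ ∫ ω, Z n ω ∂P ≤ 1 := by
  intro Z
  induction n with
  | zero =>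
    refine ⟨?_, fun ω => by simp [Z], ⟨1, by simp [Z]⟩, by simp [Z]⟩
    simp only [Z, Finset.range_zero, Finset.prod_empty]
    exact stronglyMeasurable_const
  | succ n ih =>
    obtain ⟨ih1, ih2, ⟨C, ihC⟩, ih4⟩ := ih
    have hsm : MeasurableSet[mΩ] (s n) := ℱ.le _ _ (hs n)
    set p : Ω → ℝ := P⟦s n | ℱ n⟧ with hp
    have hpm : StronglyMeasurable[ℱ n] p := stronglyMeasurable_condExp
    have hp01 := condExp_indicator_one_mem_Icc (P := P) (ℱ.le n) hsm
    set one : Ω → ℝ := (s n).indicator (fun _ => (1 : ℝ)) with hone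
    have hone01 : ∀ ω, 0 ≤ one ω ∧ one ω ≤ 1 := fun ω =>
      ⟨Set.indicator_nonneg (fun _ _ => zero_le_one) ω,
        Set.indicator_le_self' (fun _ _ => zero_le_one) ω⟩
    have honem : StronglyMeasurable[ℱ (n + 1)] one := stronglyMeasurable_const.indicator (hs n)
    have hle : ℱ n ≤ ℱ (n + 1) := ℱ.mono (Nat.le_succ n)
    have hZs : ∀ ω, Z (n + 1) ω = Z n ω * ((1 + V n ω * one ω) * Real.exp (-(V n ω * p ω))) :=
      fun ω => Finset.prod_range_succ _ _
    have hf0 : ∀ ω, 0 ≤ 1 + V n ω * one ω := fun ω => by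
      have := hone01 ω
      nlinarith [hV1 n ω, mul_nonneg this.1 (by linarith [hV1 n ω] : 0 ≤ V n ω + 1)]
    have hE : StronglyMeasurable[ℱ n] fun ω => Real.exp (-(V n ω * p ω)) :=
      Real.continuous_exp.comp_stronglyMeasurable ((hV n).mul hpm).neg
    have hVabs : ∀ ω, |V n ω| ≤ K := fun ω => abs_le.2 ⟨by linarith [hV1 n ω], hVK n ω⟩
    have hEb : ∀ᵐ ω ∂P, Real.exp (-(V n ω * p ω)) ≤ Real.exp 1 := by
      filter_upwards [hp01] with ω h
      refine Real.exp_le_exp.2 ?_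
      nlinarith [hV1 n ω, mul_nonneg h.1 (by linarith [hV1 n ω] : 0 ≤ V n ω + 1), h.2]
    have hC0 : ∀ᵐ ω ∂P, 0 ≤ C := ihC.mono fun ω h => (norm_nonneg _).trans h
    refine ⟨?_, fun ω => ?_, ⟨C * ((1 + K) * Real.exp 1), ?_⟩, ?_⟩
    · have : Z (n + 1) = fun ω => Z n ω * ((1 + V n ω * one ω) * Real.exp (-(V n ω * p ω))) :=
        funext hZs
      rw [this]
      exact (ih1.mono hle).mul ((stronglyMeasurable_const.add
        (((hV n).mono hle).mul honem)).mul (hE.mono hle))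
    · rw [hZs]
      exact mul_nonneg (ih2 ω) (mul_nonneg (hf0 ω) (Real.exp_pos _).le)
    · filter_upwards [ihC, hEb, hC0] with ω h1 h2 h3
      rw [hZs, norm_mul]
      refine mul_le_mul h1 ?_ (norm_nonneg _) h3
      rw [norm_mul, Real.norm_of_nonneg (hf0 ω), Real.norm_of_nonneg (Real.exp_pos _).le]
      refine mul_le_mul ?_ h2 (Real.exp_pos _).le (by linarith)
      have := hone01 ω
      nlinarith [hVK n ω, mul_le_mul_of_nonneg_right (hVK n ω) this.1]
    · set H : Ω → ℝ := fun ω => Z n ω * Real.exp (-(V n ω * p ω)) with hH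
      have hHm : StronglyMeasurable[ℱ n] H := ih1.mul hE
      have hHb : ∀ᵐ ω ∂P, ‖H ω‖ ≤ C * Real.exp 1 := by
        filter_upwards [ihC, hEb, hC0] with ω h1 h2 h3
        rw [hH, norm_mul, Real.norm_of_nonneg (Real.exp_pos _).le]
        exact mul_le_mul h1 h2 (Real.exp_pos _).le h3
      have hHVm : StronglyMeasurable[ℱ n] fun ω => H ω * V n ω := hHm.mul (hV n)
      have hHVb : ∀ᵐ ω ∂P, ‖H ω * V n ω‖ ≤ C * Real.exp 1 * K := by
        filter_upwards [hHb] with ω h1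
        rw [norm_mul]
        exact mul_le_mul h1 (hVabs ω) (norm_nonneg _) ((norm_nonneg _).trans h1)
      have hbdd : ∀ {f g : Ω → ℝ} {B : ℝ}, StronglyMeasurable[ℱ n] f → AEStronglyMeasurable g P →
          (∀ᵐ ω ∂P, ‖f ω‖ ≤ B) → (∀ᵐ ω ∂P, ‖g ω‖ ≤ 1) → Integrable (fun ω => f ω * g ω) P := by
        intro f g B hf hg hfB hgB
        refine Integrable.of_bound ((hf.mono (ℱ.le n)).aestronglyMeasurable.mul hg) B ?_
        filter_upwards [hfB, hgB] with ω h1 h2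
        rw [norm_mul]
        nlinarith [norm_nonneg (f ω), norm_nonneg (g ω)]
      have hHi : Integrable H P := Integrable.of_bound (hHm.mono (ℱ.le n)).aestronglyMeasurable _ hHb
      have hi1 : Integrable (fun ω => H ω * V n ω * one ω) P :=
        hbdd hHVm (honem.mono (ℱ.le _)).aestronglyMeasurable hHVb (.of_forall fun ω => by
          rw [Real.norm_of_nonneg (hone01 ω).1]; exact (hone01 ω).2)
      have hi2 : Integrable (fun ω => H ω * V n ω * p ω) P :=
        hbdd hHVm (hpm.mono (ℱ.le _)).aestronglyMeasurable hHVb (hp01.mono fun ω h => by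
          rw [Real.norm_of_nonneg h.1]; exact h.2)
      have hZi : Integrable (Z n) P := Integrable.of_bound (ih1.mono (ℱ.le n)).aestronglyMeasurable _ ihC
      calc ∫ ω, Z (n + 1) ω ∂P = ∫ ω, (H ω + H ω * V n ω * one ω) ∂P := by
            refine integral_congr_ae (.of_forall fun ω => ?_)
            simp only [hZs, hH]; ring
        _ = ∫ ω, H ω ∂P + ∫ ω, H ω * V n ω * p ω ∂P := by
            rw [integral_add hHi hi1, integral_mul_indicator_eq (ℱ.le n) hsm hHVm hHVb]
        _ = ∫ ω, (H ω + H ω * V n ω * p ω) ∂P := (integral_add hHi hi2).symm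
        _ ≤ ∫ ω, Z n ω ∂P := by
            refine integral_mono (hHi.add hi2) hZi fun ω => ?_
            have : H ω + H ω * V n ω * p ω
                = Z n ω * (Real.exp (-(V n ω * p ω)) * (1 + V n ω * p ω)) := by
              simp only [hH]; ring
            simp only [this]
            refine mul_le_of_le_one_right (ih2 ω) ?_
            rw [Real.exp_neg, inv_mul_le_one₀ (Real.exp_pos _)]
            linarith [Real.add_one_le_exp (V n ω * p ω)]
        _ ≤ 1 := ih4

end Exponential

/-- Nonnegative variables of mean at most one are almost surely `O(n ^ 2)`. -/
theorem ae_exists_le_mul_sq {Ω : Type*} {mΩ : MeasurableSpace Ω} {P : Measure Ω}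
    {G : ℕ → Ω → ℝ} (h0 : ∀ n ω, 0 ≤ G n ω)
    (hi : ∀ n, Integrable (G n) P) (h1 : ∀ n, ∫ ω, G n ω ∂P ≤ 1) :
    ∀ᵐ ω ∂P, ∃ C : ℝ, 0 < C ∧ ∀ n : ℕ, G n ω ≤ C * (n + 1 : ℝ) ^ 2 := by
  have hs : Summable fun n : ℕ => 1 / ((n : ℝ) + 1) ^ 2 := by
    simpa using (summable_nat_add_iff 1).2 (Real.summable_one_div_nat_pow.2 (one_lt_two))
  have hfin : ∫⁻ ω, ∑' n : ℕ, ENNReal.ofReal (G n ω * (1 / ((n : ℝ) + 1) ^ 2)) ∂P ≠ ⊤ := by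
    rw [lintegral_tsum fun n => ((hi n).aestronglyMeasurable.aemeasurable.mul_const _).ennreal_ofReal]
    refine ne_top_of_le_ne_top hs.tsum_ofReal_ne_top (ENNReal.tsum_le_tsum fun n => ?_)
    rw [← ofReal_integral_eq_lintegral_ofReal ((hi n).mul_const _)
      (.of_forall fun ω => mul_nonneg (h0 n ω) (by positivity)), integral_mul_const]
    exact ENNReal.ofReal_le_ofReal (mul_le_of_le_one_left (by positivity) (h1 n))
  have hae := ae_lt_top' (AEMeasurable.tsum fun n =>
    ((hi n).aestronglyMeasurable.aemeasurable.mul_const _).ennreal_ofReal) hfin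
  filter_upwards [hae] with ω hω
  refine ⟨(∑' n : ℕ, ENNReal.ofReal (G n ω * (1 / ((n : ℝ) + 1) ^ 2))).toReal + 1,
    by positivity, fun n => ?_⟩
  have h2 := ENNReal.toReal_mono hω.ne
    (ENNReal.le_tsum (f := fun n : ℕ => ENNReal.ofReal (G n ω * (1 / ((n : ℝ) + 1) ^ 2))) n)
  rw [ENNReal.toReal_ofReal (mul_nonneg (h0 n ω) (by positivity)), mul_one_div,
    div_le_iff₀ (by positivity)] at h2
  refine h2.trans ?_
  gcongr
  linarith

section Counting

variable {Ω : Type*} {mΩ : MeasurableSpace Ω} {P : Measure Ω} [IsProbabilityMeasure P]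

/-- The number of events that occur before time `n` is at least a constant multiple of the
accumulated conditional probability, up to a logarithmic error. -/
theorem ae_sum_condExp_le (ℱ : Filtration ℕ mΩ) {s : ℕ → Set Ω}
    (hs : ∀ t, MeasurableSet[ℱ (t + 1)] (s t)) :
    ∀ᵐ ω ∂P, ∃ C : ℝ, ∀ n : ℕ, (∑ t ∈ Finset.range n, (P⟦s t | ℱ t⟧) ω) / 2 ≤
      ∑ t ∈ Finset.range n, (s t).indicator (fun _ => (1 : ℝ)) ω + 2 * Real.log (n + 1) + C := by
  have he : Real.exp (-1) ≤ 1 / 2 := by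
    rw [Real.exp_neg, one_div]
    exact inv_anti₀ (by norm_num) (by linarith [Real.add_one_le_exp (1 : ℝ)])
  have hpos := Real.exp_pos (-1)
  have key := integral_prod_exp_le_one (P := P) ℱ hs
    (V := fun _ _ => Real.exp (-1) - 1) (fun _ => stronglyMeasurable_const) (K := 1)
    (fun _ _ => by linarith) (fun _ _ => by linarith) le_rfl
  have hG := ae_exists_le_mul_sq (P := P) (fun n ω => (key n).2.1 ω)
    (fun n => by
      obtain ⟨C, hC⟩ := (key n).2.2.1
      exact Integrable.of_bound ((key n).1.mono (ℱ.le n)).aestronglyMeasurable C hC)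
    (fun n => (key n).2.2.2)
  have hp : ∀ᵐ ω ∂P, ∀ t, 0 ≤ (P⟦s t | ℱ t⟧) ω :=
    ae_all_iff.2 fun t => (condExp_indicator_one_mem_Icc (ℱ.le t) (ℱ.le _ _ (hs t))).mono
      fun _ h => h.1
  filter_upwards [hG, hp] with ω ⟨C, hC0, hC⟩ hp
  refine ⟨Real.log C, fun n => ?_⟩
  have h1 := hC n
  have h2 : ∀ t, (1 + (Real.exp (-1) - 1) * (s t).indicator (fun _ => (1 : ℝ)) ω)
      = Real.exp (-(s t).indicator (fun _ => (1 : ℝ)) ω) := fun t => by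
    by_cases h : ω ∈ s t <;> simp [h]
  simp only [h2, ← Real.exp_add] at h1
  rw [← Real.exp_sum, ← Real.le_log_iff_exp_le (by positivity),
    Real.log_mul hC0.ne' (by positivity), Real.log_pow, Finset.sum_add_distrib,
    Finset.sum_neg_distrib, Finset.sum_neg_distrib, ← Finset.mul_sum] at h1
  push_cast at h1
  have h3 := Finset.sum_nonneg (s := Finset.range n) fun t _ => hp t
  nlinarith

open Classical in
/-- If the conditional probabilities of the events are below thresholds whose sum over `E n` is
bounded, then only `o (log n)` of the events with index in `E n` occur. -/
theorem ae_card_filter_le_mul_log (ℱ : Filtration ℕ mΩ) {s : ℕ → Set Ω}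
    (hs : ∀ t, MeasurableSet[ℱ (t + 1)] (s t)) (E : ℕ → Finset ℕ) {u : ℕ → ℝ} {D : ℝ}
    (hD : ∀ n, ∑ t ∈ E n, |u t| ≤ D) :
    ∀ᵐ ω ∂P, ∀ ε : ℝ, 0 < ε → ∀ᶠ n : ℕ in atTop,
      (((E n).filter fun t => ω ∈ s t ∧ (P⟦s t | ℱ t⟧) ω ≤ u t).card : ℝ) ≤ ε * Real.log n := by
  have main : ∀ K : ℕ, ∀ᵐ ω ∂P, ∃ C : ℝ, ∀ n : ℕ,
      K * (((E n).filter fun t => ω ∈ s t ∧ (P⟦s t | ℱ t⟧) ω ≤ u t).card : ℝ)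
        ≤ 2 * Real.log (n + 1) + C := by
    intro K
    have hK1 : (0 : ℝ) ≤ Real.exp K - 1 := by
      have := Real.add_one_le_exp (K : ℝ)
      have : (0 : ℝ) ≤ K := K.cast_nonneg
      linarith
    set V : ℕ → ℕ → Ω → ℝ := fun n t ω =>
      if t ∈ E n ∧ (P⟦s t | ℱ t⟧) ω ≤ u t then Real.exp K - 1 else 0 with hV
    have hVm : ∀ n t, StronglyMeasurable[ℱ t] (V n t) := by
      intro n t
      have hle : MeasurableSet[ℱ t] {ω | (P⟦s t | ℱ t⟧) ω ≤ u t} :=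
        measurableSet_le stronglyMeasurable_condExp.measurable measurable_const
      have hset : MeasurableSet[ℱ t] {ω | t ∈ E n ∧ (P⟦s t | ℱ t⟧) ω ≤ u t} :=
        (MeasurableSet.const _).inter hle
      exact StronglyMeasurable.ite hset stronglyMeasurable_const stronglyMeasurable_const
    have hV0 : ∀ n t ω, 0 ≤ V n t ω := fun n t ω => by
      simp only [hV]; split_ifs <;> simp [hK1]
    have hVK : ∀ n t ω, V n t ω ≤ Real.exp K := fun n t ω => by
      simp only [hV]; split_ifs
      · linarith
      · exact (Real.exp_pos _).le
    have key := fun n => integral_prod_exp_le_one (P := P) ℱ hs (hVm n)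
      (fun t ω => by linarith [hV0 n t ω]) (hVK n) (by linarith) ((E n).sup id + 1)
    have hG := ae_exists_le_mul_sq (P := P) (fun n ω => (key n).2.1 ω)
      (fun n => by
        obtain ⟨C, hC⟩ := (key n).2.2.1
        exact Integrable.of_bound ((key n).1.mono (ℱ.le _)).aestronglyMeasurable C hC)
      (fun n => (key n).2.2.2)
    filter_upwards [hG] with ω ⟨C, hC0, hC⟩
    refine ⟨Real.log C + (Real.exp K - 1) * D, fun n => ?_⟩
    have h1 := hC n
    set F := (E n).filter fun t => ω ∈ s t ∧ (P⟦s t | ℱ t⟧) ω ≤ u t with hF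
    have hsub : E n ⊆ Finset.range ((E n).sup id + 1) := fun t ht =>
      Finset.mem_range.2 (Nat.lt_succ_of_le (Finset.le_sup (f := id) ht))
    have hprod : ∀ t, (if t ∈ F then Real.exp K else 1) *
        Real.exp (-(if t ∈ E n then (Real.exp K - 1) * |u t| else 0)) ≤
        (1 + V n t ω * (s t).indicator (fun _ => (1 : ℝ)) ω) *
        Real.exp (-(V n t ω * (P⟦s t | ℱ t⟧) ω)) := by
      intro t
      have ha : (if t ∈ F then Real.exp K else 1)
          ≤ 1 + V n t ω * (s t).indicator (fun _ => (1 : ℝ)) ω := by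
        split_ifs with h
        · rw [hF, Finset.mem_filter] at h
          simp [hV, h.1, h.2.1, h.2.2]
        · have : 0 ≤ (s t).indicator (fun _ => (1 : ℝ)) ω :=
            Set.indicator_nonneg (fun _ _ => zero_le_one) ω
          linarith [mul_nonneg (hV0 n t ω) this]
      refine mul_le_mul ha (Real.exp_le_exp.2 (neg_le_neg ?_)) (Real.exp_pos _).le
        (le_trans (by split_ifs <;> positivity) ha)
      by_cases h : t ∈ E n
      · by_cases h' : (P⟦s t | ℱ t⟧) ω ≤ u t
        · simp only [hV, h, h', and_self, if_true]
          exact mul_le_mul_of_nonneg_left (h'.trans (le_abs_self _)) hK1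
        · simp only [hV, h, h', and_false, if_false, if_true, zero_mul]
          positivity
      · simp [hV, h]
    have h2 := (Finset.prod_le_prod (s := Finset.range ((E n).sup id + 1))
      (fun t _ => by split_ifs <;> positivity) (fun t _ => hprod t)).trans h1
    rw [Finset.prod_mul_distrib, ← Real.exp_sum, Finset.sum_neg_distrib, Finset.prod_ite_mem,
      Finset.sum_ite_mem, Finset.inter_eq_right.2 hsub,
      Finset.inter_eq_right.2 ((Finset.filter_subset _ _).trans hsub), Finset.prod_const,
      ← Real.exp_nat_mul, ← Real.exp_add, ← Finset.mul_sum, ← Real.le_log_iff_exp_le (by positivity),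
      Real.log_mul hC0.ne' (by positivity), Real.log_pow] at h2
    push_cast at h2
    have h3 := mul_le_mul_of_nonneg_left (hD n) hK1
    linarith
  filter_upwards [ae_all_iff.2 main] with ω hω ε hε
  obtain ⟨K, hK⟩ := exists_nat_gt (4 / ε)
  have hK0 : (0 : ℝ) < K := lt_trans (by positivity) hK
  obtain ⟨C, hC⟩ := hω K
  have hlog : Tendsto (fun n : ℕ => Real.log n) atTop atTop :=
    Real.tendsto_log_atTop.comp tendsto_natCast_atTop_atTop
  rw [div_lt_iff₀ hε] at hK
  have hgap : 0 < K * ε - 2 := by linarith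
  filter_upwards [hlog.eventually_ge_atTop ((2 * Real.log 2 + C) / (K * ε - 2)),
    eventually_ge_atTop 1] with n hn h1
  rw [div_le_iff₀ hgap] at hn
  have h1' : (1 : ℝ) ≤ n := by exact_mod_cast h1
  have h2 : Real.log (n + 1) ≤ Real.log 2 + Real.log n := by
    rw [← Real.log_mul (by norm_num) (by positivity)]
    exact Real.log_le_log (by positivity) (by linarith)
  refine le_of_mul_le_mul_left ((hC n).trans ?_) hK0
  linarith

end Counting

/-! ### A strong law for adaptively selected rewards -/

/-- Summation by parts, with the partial sums of `x t / b (t + 1)` centred at `ℓ`. -/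
theorem sum_eq_abel {b x : ℕ → ℝ} (hb : ∀ n, 0 < b n) (ℓ : ℝ) (n : ℕ) :
    ∑ t ∈ Finset.range n, x t = b n * (∑ t ∈ Finset.range n, x t / b (t + 1) - ℓ) -
      ∑ t ∈ Finset.range n, (b (t + 1) - b t) * (∑ r ∈ Finset.range t, x r / b (r + 1) - ℓ)
      + b 0 * ℓ := by
  induction n with
  | zero => simp
  | succ n ih =>
    rw [Finset.sum_range_succ, ih, Finset.sum_range_succ _ n, Finset.sum_range_succ _ n]
    have := (hb (n + 1)).ne'
    field_simp
    ring

/-- **Kronecker's lemma**. -/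
theorem tendsto_sum_div_of_tendsto {b x : ℕ → ℝ} (hb : ∀ n, 0 < b n) (hmono : Monotone b)
    (htop : Tendsto b atTop atTop) {ℓ : ℝ}
    (h : Tendsto (fun n => ∑ t ∈ Finset.range n, x t / b (t + 1)) atTop (𝓝 ℓ)) :
    Tendsto (fun n => (∑ t ∈ Finset.range n, x t) / b n) atTop (𝓝 0) := by
  have h0 : Tendsto (fun n => ∑ t ∈ Finset.range n, x t / b (t + 1) - ℓ) atTop (𝓝 0) :=
    tendsto_sub_nhds_zero_iff.2 h
  have h1 : (fun n => (b (n + 1) - b n) * (∑ r ∈ Finset.range n, x r / b (r + 1) - ℓ))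
      =o[atTop] fun n => b (n + 1) - b n := by
    simpa using (Asymptotics.isBigO_refl (fun n => b (n + 1) - b n) atTop).mul_isLittleO
      ((Asymptotics.isLittleO_one_iff ℝ).2 h0)
  have h2 := h1.sum_range (fun n => sub_nonneg.2 (hmono n.le_succ)) (by
    simp only [Finset.sum_range_sub]
    exact tendsto_atTop_add_const_right _ _ htop)
  simp only [Finset.sum_range_sub] at h2
  have h3 : (fun n => b n - b 0) =O[atTop] b := by
    refine Asymptotics.IsBigO.of_bound 1 (.of_forall fun n => ?_)
    rw [Real.norm_of_nonneg (sub_nonneg.2 (hmono n.zero_le)), Real.norm_of_nonneg (hb n).le]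
    linarith [hb 0]
  have h4 := (h2.trans_isBigO h3).tendsto_div_nhds_zero
  have h5 : Tendsto (fun n => b 0 * ℓ / b n) atTop (𝓝 0) := htop.const_div_atTop _
  have h6 := (h0.sub h4).add h5
  rw [sub_zero, add_zero] at h6
  refine h6.congr fun n => ?_
  rw [sum_eq_abel (x := x) hb ℓ n, add_div, sub_div, mul_div_cancel_left₀ _ (hb n).ne']

theorem exists_abs_sum_le_of_tendsto {b x : ℕ → ℝ} (hb : ∀ n, 0 < b n) (hmono : Monotone b)
    {ℓ : ℝ} (h : Tendsto (fun n => ∑ t ∈ Finset.range n, x t / b (t + 1)) atTop (𝓝 ℓ)) :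
    ∃ B, ∀ n, |∑ t ∈ Finset.range n, x t| ≤ B * b n := by
  obtain ⟨B, hB⟩ := (h.abs).bddAbove_range
  have hB' : ∀ n, |∑ t ∈ Finset.range n, x t / b (t + 1)| ≤ B := fun n => hB ⟨n, rfl⟩
  have hB0 : 0 ≤ B := (abs_nonneg _).trans (hB' 0)
  refine ⟨2 * B, fun n => ?_⟩
  rw [sum_eq_abel hb 0 n]
  simp only [sub_zero, mul_zero, add_zero]
  have h1 : |∑ t ∈ Finset.range n, (b (t + 1) - b t) * ∑ r ∈ Finset.range t, x r / b (r + 1)|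
      ≤ ∑ t ∈ Finset.range n, (b (t + 1) - b t) * B := by
    refine (Finset.abs_sum_le_sum_abs _ _).trans (Finset.sum_le_sum fun t _ => ?_)
    have := sub_nonneg.2 (hmono t.le_succ)
    rw [abs_mul, abs_of_nonneg this]
    exact mul_le_mul_of_nonneg_left (hB' t) this
  rw [← Finset.sum_mul, Finset.sum_range_sub] at h1
  have h2 : |b n * ∑ t ∈ Finset.range n, x t / b (t + 1)| ≤ b n * B := by
    rw [abs_mul, abs_of_pos (hb n)]
    exact mul_le_mul_of_nonneg_left (hB' n) (hb n).le
  have h3 := abs_sub (b n * ∑ t ∈ Finset.range n, x t / b (t + 1))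
    (∑ t ∈ Finset.range n, (b (t + 1) - b t) * ∑ r ∈ Finset.range t, x r / b (r + 1))
  nlinarith [mul_nonneg (hb 0).le hB0]

section Selection

variable {Ω : Type*} {mΩ : MeasurableSpace Ω} {P : Measure Ω} [IsProbabilityMeasure P]

/-- One plus the number of events that occur before time `n`. -/
noncomputable def eventCount (s : ℕ → Set Ω) (n : ℕ) (ω : Ω) : ℝ :=
  1 + ∑ t ∈ Finset.range n, (s t).indicator (fun _ => (1 : ℝ)) ω

theorem eventCount_succ (s : ℕ → Set Ω) (n : ℕ) (ω : Ω) :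
    eventCount s (n + 1) ω = eventCount s n ω + (s n).indicator (fun _ => (1 : ℝ)) ω := by
  rw [eventCount, Finset.sum_range_succ, eventCount]
  ring

theorem one_le_eventCount (s : ℕ → Set Ω) (n : ℕ) (ω : Ω) : 1 ≤ eventCount s n ω :=
  le_add_of_nonneg_right (Finset.sum_nonneg fun _ _ =>
    Set.indicator_nonneg (fun _ _ => zero_le_one) ω)

/-- The weights `1_{s t} / b (t + 1)`, with `b` the event count, are square summable. -/
theorem sum_sq_weight_le (s : ℕ → Set Ω) (n : ℕ) (ω : Ω) :
    ∑ t ∈ Finset.range n, ((s t).indicator (fun _ => (1 : ℝ)) ω / eventCount s (t + 1) ω) ^ 2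
      ≤ 1 - 1 / eventCount s n ω := by
  induction n with
  | zero => simp [eventCount]
  | succ n ih =>
    rw [Finset.sum_range_succ, eventCount_succ]
    have hb := one_le_eventCount s n ω
    by_cases h : ω ∈ s n
    · simp only [Set.indicator_of_mem h]
      have : (1 / (eventCount s n ω + 1)) ^ 2 ≤ 1 / eventCount s n ω - 1 / (eventCount s n ω + 1) := by
        rw [div_sub_div _ _ (by positivity) (by positivity), div_pow,
          div_le_div_iff₀ (by positivity) (by positivity)]
        nlinarith
      linarith
    · simpa [Set.indicator_of_notMem h] using ih

/-- Centred rewards of bounded variance, selected by events that do not anticipate them, satisfy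
the strong law of large numbers along the selected times: dividing the reward by the current event
count gives an `L²`-bounded martingale, and Kronecker's lemma applies. -/
theorem ae_tendsto_sum_weight (ℱ : Filtration ℕ mΩ) (ℋ : ℕ → MeasurableSpace Ω)
    (hℱℋ : ∀ t, ℱ t ≤ ℋ t) (hℋℱ : ∀ t, ℋ t ≤ ℱ (t + 1)) {s : ℕ → Set Ω}
    (hs : ∀ t, MeasurableSet[ℋ t] (s t)) {X : ℕ → Ω → ℝ}
    (hX : ∀ t, Measurable[ℱ (t + 1)] (X t)) (hX2 : ∀ t, MemLp (X t) 2 P)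
    (hX0 : ∀ t, ∫ ω, X t ω ∂P = 0) {V : ℝ} (hV : ∀ t, ∫ ω, X t ω ^ 2 ∂P ≤ V)
    (hind : ∀ t, Indep (ℋ t) (MeasurableSpace.comap (X t) inferInstance) P) :
    ∀ᵐ ω ∂P, ∃ ℓ : ℝ, Tendsto (fun n => ∑ t ∈ Finset.range n,
      ((s t).indicator (fun _ => (1 : ℝ)) ω * X t ω) / eventCount s (t + 1) ω) atTop (𝓝 ℓ) := by
  have hℋ : ∀ t, ℋ t ≤ mΩ := fun t => (hℋℱ t).trans (ℱ.le _)
  set w : ℕ → Ω → ℝ := fun t ω =>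
    (s t).indicator (fun _ => (1 : ℝ)) ω / eventCount s (t + 1) ω with hw
  have hs' : ∀ t, ∀ r ≤ t, MeasurableSet[ℋ t] (s r) := fun t r hr => by
    rcases hr.eq_or_lt with rfl | hlt
    · exact hs r
    · exact hℱℋ t _ (ℱ.mono hlt _ (hℋℱ r _ (hs r)))
  have hbm : ∀ t, Measurable[ℋ t] (eventCount s (t + 1)) := fun t => by
    have : eventCount s (t + 1) = fun ω =>
      1 + ∑ r ∈ Finset.range (t + 1), (s r).indicator (fun _ => (1 : ℝ)) ω := rfl
    rw [this]
    refine measurable_const.add (Finset.measurable_fun_sum _ fun r hr => ?_)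
    exact measurable_const.indicator (hs' t r (Nat.lt_succ_iff.1 (Finset.mem_range.1 hr)))
  have hwm : ∀ t, Measurable[ℋ t] (w t) := fun t =>
    (measurable_const.indicator (hs t)).div (hbm t)
  have hw01 : ∀ t ω, 0 ≤ w t ω ∧ w t ω ≤ 1 := fun t ω => by
    have hb := one_le_eventCount s (t + 1) ω
    have h0 : 0 ≤ (s t).indicator (fun _ => (1 : ℝ)) ω :=
      Set.indicator_nonneg (fun _ _ => zero_le_one) ω
    have h1 : (s t).indicator (fun _ => (1 : ℝ)) ω ≤ 1 :=
      Set.indicator_le_self' (fun _ _ => zero_le_one) ω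
    exact ⟨div_nonneg h0 (by linarith), div_le_one_of_le₀ (h1.trans hb) (by linarith)⟩
  have hmul : ∀ t (f : Ω → ℝ) (g : ℝ → ℝ), Measurable[ℋ t] f → Measurable g →
      ∫ ω, f ω * g (X t ω) ∂P = (∫ ω, f ω ∂P) * ∫ ω, g (X t ω) ∂P := by
    intro t f g hf hg
    have hi : IndepFun f (g ∘ X t) P := by
      rw [IndepFun_iff_Indep]
      refine indep_of_indep_of_le_right (indep_of_indep_of_le_left (hind t) hf.comap_le) ?_
      rw [← MeasurableSpace.comap_comp]
      exact MeasurableSpace.comap_mono hg.comap_le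
    exact hi.integral_fun_mul_eq_mul_integral (hf.mono (hℋ t) le_rfl).aestronglyMeasurable
      (hg.comp ((hX t).mono (ℱ.le _) le_rfl)).aestronglyMeasurable
  set M : ℕ → Ω → ℝ := fun n ω => ∑ t ∈ Finset.range n, w t ω * X t ω with hM
  have hd2 : ∀ t, MemLp (fun ω => w t ω * X t ω) 2 P := fun t => by
    refine (hX2 t).mono (((hwm t).mono (hℋ t) le_rfl).mul
      ((hX t).mono (ℱ.le _) le_rfl)).aestronglyMeasurable (.of_forall fun ω => ?_)
    rw [norm_mul, Real.norm_of_nonneg (hw01 t ω).1]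
    exact mul_le_of_le_one_left (norm_nonneg _) (hw01 t ω).2
  have hM2 : ∀ n, MemLp (M n) 2 P := fun n => memLp_finsetSum _ fun t _ => hd2 t
  have hMm : ∀ n, Measurable[ℱ n] (M n) := fun n => by
    refine Finset.measurable_fun_sum _ fun t ht => ?_
    have hle : ℱ (t + 1) ≤ ℱ n := ℱ.mono (Finset.mem_range.1 ht)
    exact ((hwm t).mono ((hℋℱ t).trans hle) le_rfl).mul ((hX t).mono hle le_rfl)
  have hMs : ∀ n ω, M (n + 1) ω = M n ω + w n ω * X n ω := fun n ω => Finset.sum_range_succ _ _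
  have hmart : Martingale M ℱ P := by
    refine martingale_of_setIntegral_eq_succ (fun n => (hMm n).stronglyMeasurable)
      (fun n => (hM2 n).integrable one_le_two) fun n S hS => ?_
    have h1 : ∫ ω in S, w n ω * X n ω ∂P = 0 := by
      rw [← integral_indicator (ℱ.le n S hS)]
      have := hmul n (S.indicator (w n)) id ((hwm n).indicator (hℱℋ n S hS)) measurable_id
      simp only [id, hX0, mul_zero] at this
      rw [← this]
      refine integral_congr_ae (.of_forall fun ω => ?_)
      by_cases h : ω ∈ S <;> simp [h]
    simp only [hMs]
    rw [integral_add ((hM2 n).integrable one_le_two).integrableOn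
      ((hd2 n).integrable one_le_two).integrableOn, h1, add_zero]
  have hV0 : 0 ≤ V := (integral_nonneg fun ω => sq_nonneg _).trans (hV 0)
  have hw2i : ∀ t, Integrable (fun ω => w t ω ^ 2) P := fun t => by
    refine Integrable.of_bound (((hwm t).mono (hℋ t) le_rfl).pow_const 2).aestronglyMeasurable 1
      (.of_forall fun ω => ?_)
    rw [Real.norm_of_nonneg (sq_nonneg _)]
    exact pow_le_one₀ (hw01 t ω).1 (hw01 t ω).2
  have hsq : ∀ n, ∫ ω, M n ω ^ 2 ∂P ≤ V * ∑ t ∈ Finset.range n, ∫ ω, w t ω ^ 2 ∂P := by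
    intro n
    induction n with
    | zero => simp [hM]
    | succ n ih =>
      have h1 : ∫ ω, M n ω * w n ω * X n ω ∂P = 0 := by
        have := hmul n (fun ω => M n ω * w n ω) id
          (((hMm n).mono (hℱℋ n) le_rfl).mul (hwm n)) measurable_id
        simpa [hX0] using this
      have h2 : ∫ ω, (w n ω * X n ω) ^ 2 ∂P ≤ V * ∫ ω, w n ω ^ 2 ∂P := by
        have := hmul n (fun ω => w n ω ^ 2) (fun x => x ^ 2) ((hwm n).pow_const 2)
          (measurable_id.pow_const 2)
        simp only [mul_pow, this]
        rw [mul_comm]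
        exact mul_le_mul_of_nonneg_right (hV n) (integral_nonneg fun ω => sq_nonneg _)
      have hi1 : Integrable (fun ω => M n ω * w n ω * X n ω) P := by
        have := (hM2 n).integrable_mul (hd2 n)
        refine this.congr (.of_forall fun ω => ?_)
        simp [mul_assoc]
      have e : ∀ ω, M (n + 1) ω ^ 2
          = M n ω ^ 2 + 2 * (M n ω * w n ω * X n ω) + (w n ω * X n ω) ^ 2 := fun ω => by
        rw [hMs]; ring
      simp only [e]
      have hi2 : Integrable (fun ω => M n ω ^ 2 + 2 * (M n ω * w n ω * X n ω)) P :=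
        (hM2 n).integrable_sq.add (hi1.const_mul 2)
      rw [integral_add hi2 (hd2 n).integrable_sq,
        integral_add (hM2 n).integrable_sq (hi1.const_mul 2), integral_const_mul, h1,
        Finset.sum_range_succ, mul_add]
      linarith
  have hsqV : ∀ n, ∫ ω, M n ω ^ 2 ∂P ≤ V := fun n => by
    refine (hsq n).trans (mul_le_of_le_one_right hV0 ?_)
    rw [← integral_finsetSum _ fun t _ => hw2i t]
    calc ∫ ω, ∑ t ∈ Finset.range n, w t ω ^ 2 ∂P ≤ ∫ _, (1 : ℝ) ∂P := by
          refine integral_mono (integrable_finsetSum _ fun t _ => hw2i t) (integrable_const _)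
            fun ω => (sum_sq_weight_le s n ω).trans ?_
          have := one_le_eventCount s n ω
          have : 0 ≤ 1 / eventCount s n ω := by positivity
          linarith
      _ = 1 := by simp
  have hbdd : ∀ n, eLpNorm (M n) 1 P ≤ (V.toNNReal + 1 : ℝ≥0) := fun n => by
    rw [eLpNorm_one_eq_lintegral_enorm, ← ofReal_integral_norm_eq_lintegral_enorm
      ((hM2 n).integrable one_le_two), ENNReal.ofReal_le_iff_le_toReal ENNReal.coe_ne_top,
      ENNReal.coe_toReal, NNReal.coe_add, Real.coe_toNNReal _ hV0]
    calc ∫ ω, ‖M n ω‖ ∂P ≤ ∫ ω, (M n ω ^ 2 + 1) ∂P := by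
          refine integral_mono ((hM2 n).integrable one_le_two).norm
            ((hM2 n).integrable_sq.add (integrable_const _)) fun ω => ?_
          simp only [Real.norm_eq_abs]
          nlinarith [sq_abs (M n ω), sq_nonneg (|M n ω| - 1), abs_nonneg (M n ω)]
      _ ≤ V + 1 := by
          rw [integral_add (hM2 n).integrable_sq (integrable_const _)]
          simpa using hsqV n
  filter_upwards [hmart.submartingale.ae_tendsto_limitProcess hbdd] with ω hω
  refine ⟨_, hω.congr fun n => Finset.sum_congr rfl fun t _ => ?_⟩
  simp only [hw]
  ring

end Selection

/-! ### The filtration of the past and the conditional probability of an action -/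

section Model

variable {Ω : Type*} {I : ℕ} {Y θ : Fin I → ℕ → Ω → ℝ} {A : ℕ → Ω → Fin I}

theorem measurable_past_last (t : ℕ) :
    Measurable[MeasurableSpace.comap (past Y θ A (t + 1)) inferInstance]
      (fun ω => ((fun i => Y i t ω : Fin I → ℝ), (fun i => θ i t ω : Fin I → ℝ), A t ω)) :=
  (measurable_pi_apply (Fin.last t)).comp (comap_measurable (past Y θ A (t + 1)))

theorem sum_indicator_eq_pullCount (i : Fin I) (n : ℕ) (ω : Ω) :
    ∑ t ∈ Finset.range n, (A t ⁻¹' {i}).indicator (fun _ => (1 : ℝ)) ω = pullCount A i n ω := by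
  rw [pullCount, Finset.card_filter, Nat.cast_sum]
  refine Finset.sum_congr rfl fun t _ => ?_
  by_cases h : A t ω = i <;> simp [h]

variable [mΩ : MeasurableSpace Ω]

theorem measurable_past (hY : ∀ i t, Measurable (Y i t)) (hθ : ∀ i t, Measurable (θ i t))
    (hA : ∀ t, Measurable (A t)) (t : ℕ) : Measurable (past Y θ A t) :=
  measurable_pi_lambda _ fun s => (measurable_pi_lambda _ fun i => hY i s).prodMk
    ((measurable_pi_lambda _ fun i => hθ i s).prodMk (hA s))

/-- The filtration generated by all rewards, sampled indices and actions. -/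
def pastFiltration (hY : ∀ i t, Measurable (Y i t)) (hθ : ∀ i t, Measurable (θ i t))
    (hA : ∀ t, Measurable (A t)) : Filtration ℕ mΩ where
  seq t := MeasurableSpace.comap (past Y θ A t) inferInstance
  mono' := by
    intro t t' h
    have : past Y θ A t = (fun f (s : Fin t) => f (Fin.castLE h s)) ∘ past Y θ A t' := rfl
    simp only
    rw [this, ← MeasurableSpace.comap_comp]
    exact MeasurableSpace.comap_mono
      (measurable_pi_lambda _ fun s => measurable_pi_apply _).comap_le
  le' t := (measurable_past hY hθ hA t).comap_le

/-- The conditional probability, given the past, that arm `i` is played in round `t`. -/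
noncomputable def actionProb {Ω : Type*} [MeasurableSpace Ω] (P : Measure Ω)
    (Y θ : Fin I → ℕ → Ω → ℝ) (A : ℕ → Ω → Fin I) (i : Fin I) (t : ℕ) : Ω → ℝ :=
  P⟦A t ⁻¹' {i} | MeasurableSpace.comap (past Y θ A t) inferInstance⟧

theorem pi_real_box {G : Fin I → Measure ℝ} [∀ k, IsProbabilityMeasure (G k)]
    (s : Fin I → Set ℝ) : (Measure.pi G).real (Set.univ.pi s) = ∏ k, (G k).real (s k) := by
  rw [measureReal_def, Measure.pi_pi, ENNReal.toReal_prod]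
  rfl

theorem pi_real_eval_preimage {G : Fin I → Measure ℝ} [∀ k, IsProbabilityMeasure (G k)]
    (k : Fin I) {s : Set ℝ} (hs : MeasurableSet s) :
    (Measure.pi G).real ((fun f => f k) ⁻¹' s) = (G k).real s := by
  rw [← map_measureReal_apply (measurable_pi_apply k) hs, (measurePreserving_eval G k).map_eq]

end Model

section Thompson

variable {Ω : Type*} [mΩ : MeasurableSpace Ω] {P : Measure Ω} [IsProbabilityMeasure P] {I : ℕ}
  {Y θ : Fin I → ℕ → Ω → ℝ} {A : ℕ → Ω → Fin I} {T : ℕ → Ω → ℕ} {μ : Fin I → ℝ}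

/-- The law of the index of arm `i` that is sampled when the last feedback came at time `n`. -/
noncomputable def indexLaw (Y : Fin I → ℕ → Ω → ℝ) (A : ℕ → Ω → Fin I) (i : Fin I) (n : ℕ) (ω : Ω) :
    Measure ℝ :=
  gaussianReal (postMean Y A i n ω) (postVar A i n ω)

instance (i : Fin I) (n : ℕ) (ω : Ω) : IsProbabilityMeasure (indexLaw Y A i n ω) := by
  unfold indexLaw; infer_instance

/-- If the index of arm `i` is above a level and the others are not, then arm `i` is played. -/
theorem IsThompsonSampling.ae_prod_le_actionProb (h : IsThompsonSampling P Y θ A T)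
    (i : Fin I) (t : ℕ) (q : ℝ) :
    ∀ᵐ ω ∂P, (indexLaw Y A i (lastFeedback T t ω) ω).real (Set.Ioi q) *
      ∏ k ∈ Finset.univ.erase i, (indexLaw Y A k (lastFeedback T t ω) ω).real (Set.Iic q)
      ≤ actionProb P Y θ A i t ω := by
  set s : Fin I → Set ℝ := fun k => if k = i then Set.Ioi q else Set.Iic q with hs
  have hsm : ∀ k, MeasurableSet (s k) := fun k => by
    simp only [hs]; split_ifs
    exacts [measurableSet_Ioi, measurableSet_Iic]
  have hB : MeasurableSet (Set.univ.pi s) := MeasurableSet.univ_pi hsm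
  have hθm : Measurable fun ω i => θ i t ω := measurable_pi_lambda _ fun i => h.measurable_index i t
  have hsub : (fun ω i => θ i t ω) ⁻¹' Set.univ.pi s ⊆ A t ⁻¹' {i} := by
    intro ω hω
    by_contra hne
    have h1 : q < θ i t ω := by simpa [hs] using hω i (Set.mem_univ i)
    have h2 : θ (A t ω) t ω ≤ q := by
      simpa [hs, show A t ω ≠ i from hne] using hω (A t ω) (Set.mem_univ _)
    linarith [h.argmax t ω i]
  have hmono := condExp_mono (m := MeasurableSpace.comap (past Y θ A t) inferInstance) (μ := P)
    ((integrable_const (1 : ℝ)).indicator (hθm hB))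
    ((integrable_const (1 : ℝ)).indicator (h.measurable_arm t (measurableSet_singleton i)))
    (.of_forall fun ω => Set.indicator_le_indicator_of_subset hsub (fun _ => zero_le_one) ω)
  filter_upwards [h.sample t _ hB, hmono] with ω h1 h2
  refine le_trans (le_of_eq ?_) (h1.symm.le.trans h2)
  change _ = (Measure.pi fun k => indexLaw Y A k (lastFeedback T t ω) ω).real _
  rw [pi_real_box, ← Finset.mul_prod_erase _ _ (Finset.mem_univ i)]
  congr 1
  · simp [hs]
  · refine Finset.prod_congr rfl fun k hk => ?_
    simp [hs, Finset.ne_of_mem_erase hk]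

/-- If arm `i` is played, then its index is at least a given level or that of arm `0` is at most
that level. -/
theorem IsThompsonSampling.ae_actionProb_le [NeZero I] (h : IsThompsonSampling P Y θ A T)
    (i : Fin I) (t : ℕ) (q : ℝ) :
    ∀ᵐ ω ∂P, actionProb P Y θ A i t ω ≤ (indexLaw Y A i (lastFeedback T t ω) ω).real (Set.Ici q) +
      (indexLaw Y A 0 (lastFeedback T t ω) ω).real (Set.Iic q) := by
  set B : Set (Fin I → ℝ) := (fun f => f i) ⁻¹' Set.Ici q ∪ (fun f => f 0) ⁻¹' Set.Iic q with hBdef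
  have hB : MeasurableSet B := (measurable_pi_apply i measurableSet_Ici).union
    (measurable_pi_apply 0 measurableSet_Iic)
  have hθm : Measurable fun ω i => θ i t ω := measurable_pi_lambda _ fun i => h.measurable_index i t
  have hsub : A t ⁻¹' {i} ⊆ (fun ω i => θ i t ω) ⁻¹' B := by
    intro ω hω
    have h1 : A t ω = i := hω
    by_contra hne
    simp only [hBdef, Set.mem_preimage, Set.mem_union, Set.mem_Ici, Set.mem_Iic, not_or, not_le]
      at hne
    have := h.argmax t ω 0
    rw [h1] at this
    linarith
  have hmono := condExp_mono (m := MeasurableSpace.comap (past Y θ A t) inferInstance) (μ := P)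
    ((integrable_const (1 : ℝ)).indicator (h.measurable_arm t (measurableSet_singleton i)))
    ((integrable_const (1 : ℝ)).indicator (hθm hB))
    (.of_forall fun ω => Set.indicator_le_indicator_of_subset hsub (fun _ => zero_le_one) ω)
  filter_upwards [h.sample t _ hB, hmono] with ω h1 h2
  refine (h2.trans h1.le).trans ?_
  change (Measure.pi fun k => indexLaw Y A k (lastFeedback T t ω) ω).real _ ≤ _
  refine (measureReal_union_le _ _).trans (le_of_eq ?_)
  rw [pi_real_eval_preimage i measurableSet_Ici, pi_real_eval_preimage 0 measurableSet_Iic]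

/-- The centred rewards of arm `k` collected over the rounds in which arm `i` is played, divided by
the running number of these rounds, form a convergent series. -/
theorem ae_exists_tendsto_selected (hY : IsRewardModel P Y μ) (h : IsThompsonSampling P Y θ A T)
    (i k : Fin I) :
    ∀ᵐ ω ∂P, ∃ ℓ : ℝ, Tendsto (fun n => ∑ t ∈ Finset.range n,
      (if A t ω = i then Y k t ω - μ k else 0) / (1 + (pullCount A i (t + 1) ω : ℝ)))
        atTop (𝓝 ℓ) := by
  set ℱ := pastFiltration hY.measurable h.measurable_index h.measurable_arm with hℱ
  set S : ℕ → Ω → (∀ _ : Fin I, ℝ) := fun t ω i => Y i t ω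
  have hlast : ∀ t, Measurable[ℱ (t + 1)]
      (fun ω => ((fun i => Y i t ω : Fin I → ℝ), (fun i => θ i t ω : Fin I → ℝ), A t ω)) :=
    fun t => measurable_past_last t
  have hYk : ∀ t, IdentDistrib (fun ω => Y k t ω - μ k) (fun ω => Y k 0 ω - μ k) P P := fun t =>
    (hY.identDistrib k t).comp (u := fun x => x - μ k) (measurable_id.sub_const _)
  have hX0 : MemLp (fun ω => Y k 0 ω - μ k) 2 P := (hY.memLp k).sub (memLp_const _)
  have key := ae_tendsto_sum_weight (P := P) ℱ
    (fun t => MeasurableSpace.comap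
      (fun ω => (past Y θ A t ω, (fun i => θ i t ω : Fin I → ℝ), A t ω)) inferInstance)
    (fun t => ?_) (fun t => ?_) (s := fun t => A t ⁻¹' {i}) (fun t => ?_)
    (X := fun t ω => Y k t ω - μ k) (fun t => ?_) (fun t => ?_) (fun t => ?_)
    (V := ∫ ω, (Y k 0 ω - μ k) ^ 2 ∂P) (fun t => ?_) (fun t => ?_)
  · filter_upwards [key] with ω ⟨ℓ, hℓ⟩
    refine ⟨ℓ, hℓ.congr fun n => Finset.sum_congr rfl fun t _ => ?_⟩
    rw [eventCount, sum_indicator_eq_pullCount]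
    by_cases hA : A t ω = i <;> simp [hA]
  · exact (measurable_fst.comp (comap_measurable
      (fun ω => (past Y θ A t ω, (fun i => θ i t ω : Fin I → ℝ), A t ω)))).comap_le
  · refine Measurable.comap_le ?_
    have h1 : Measurable[ℱ (t + 1)] (past Y θ A t) :=
      (comap_measurable (past Y θ A t)).mono (ℱ.mono t.le_succ) le_rfl
    exact h1.prodMk (measurable_snd.comp (hlast t))
  · exact (measurable_snd.comp (measurable_snd.comp (comap_measurable
      (fun ω => (past Y θ A t ω, (fun i => θ i t ω : Fin I → ℝ), A t ω)))))
      (measurableSet_singleton i)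
  · exact ((measurable_pi_apply k).comp (measurable_fst.comp (hlast t))).sub_const _
  · exact (hYk t).symm.memLp_snd hX0
  · rw [(hYk t).integral_eq, integral_sub ((hY.memLp k).integrable one_le_two)
      (integrable_const _), hY.mean k]
    simp
  · exact ((hYk t).comp (u := fun x => x ^ 2) (measurable_id.pow_const 2)).integral_eq.le
  · have h1 := (IndepFun_iff_Indep _ _ _).1 (h.reward_indep t).symm
    refine indep_of_indep_of_le_right h1 ?_
    exact (((measurable_pi_apply k).comp (comap_measurable
      (fun ω (i : Fin I) => Y i t ω))).sub_const (μ k)).comap_le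

end Thompson

/-! ### Pathwise analysis: accuracy of the estimates and action probabilities -/

/-- The number of pulls of arm `i` before time `n` along a sequence `a` of actions. -/
def pathCount {I : ℕ} (a : ℕ → Fin I) (i : Fin I) (n : ℕ) : ℕ :=
  ((Finset.range n).filter fun s => a s = i).card

/-- The almost sure properties of a trajectory from which the asymptotics of the numbers of pulls
follow. Here `a` is the sequence of actions, `p i t` the conditional probability of playing arm `i`
in round `t`, `m i n` the pseudo-posterior mean at time `n`, and `g t` the time of the last
feedback before round `t`. Exponents and levels are taken from countable families. -/
structure IsTypicalPath {I : ℕ} [NeZero I] (μ : Fin I → ℝ) (a : ℕ → Fin I) (p m : Fin I → ℕ → ℝ)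
    (g : ℕ → ℕ) : Prop where
  nonneg : ∀ i t, 0 ≤ p i t
  accum : ∀ i, ∃ C : ℝ, ∀ n : ℕ, (∑ t ∈ Finset.range n, p i t) / 2 ≤
    pathCount a i n + 2 * Real.log (n + 1) + C
  rare : ∀ i (k : ℕ) (ε : ℝ), 0 < ε → ∀ᶠ n : ℕ in atTop,
    (((Finset.range n).filter fun t =>
      a t = i ∧ p i t ≤ (t : ℝ) ^ (-(1 + 1 / ((k : ℝ) + 1)))).card : ℝ) ≤ ε * Real.log n
  window : ∀ i (k : ℕ) (ε : ℝ), 0 < ε → ∀ᶠ n : ℕ in atTop,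
    (((Finset.Icc n (n + ⌊(n : ℝ) ^ (1 - 2 / ((k : ℝ) + 2))⌋₊)).filter fun t =>
      a t = i ∧ p i t ≤ (t : ℝ) ^ (-(1 - 1 / ((k : ℝ) + 2)))).card : ℝ) ≤ ε * Real.log n
  bounded : ∀ i, ∃ B : ℝ, ∀ n, |m i n| ≤ B
  consistent : ∀ i, Tendsto (pathCount a i) atTop atTop → Tendsto (m i) atTop (𝓝 (μ i))
  prod_le : ∀ i t (q : ℚ),
    (gaussianReal (m i (g t)) (1 / (1 + (pathCount a i (g t) : ℝ≥0)))).real (Set.Ioi (q : ℝ)) *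
      ∏ k ∈ Finset.univ.erase i,
        (gaussianReal (m k (g t)) (1 / (1 + (pathCount a k (g t) : ℝ≥0)))).real (Set.Iic (q : ℝ))
      ≤ p i t
  le_add : ∀ i t (q : ℚ), p i t ≤
    (gaussianReal (m i (g t)) (1 / (1 + (pathCount a i (g t) : ℝ≥0)))).real (Set.Ici (q : ℝ)) +
    (gaussianReal (m 0 (g t)) (1 / (1 + (pathCount a 0 (g t) : ℝ≥0)))).real (Set.Iic (q : ℝ))
  feedback_le : ∀ t, g t ≤ t
  tendsto_feedback : Tendsto g atTop atTop
  growth : ∃ k : ℕ, ∀ᶠ t : ℕ in atTop, (t : ℝ) ≤ g t + (g t : ℝ) ^ (1 - 2 / ((k : ℝ) + 2))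

section Pathwise

variable {I : ℕ} {a : ℕ → Fin I}

theorem pathCount_mono (a : ℕ → Fin I) (i : Fin I) : Monotone (pathCount a i) := fun _ _ h =>
  Finset.card_le_card (Finset.filter_subset_filter _ (Finset.range_mono h))

theorem var_ne_zero (N : ℕ) : (1 / (1 + (N : ℝ≥0)) : ℝ≥0) ≠ 0 := by positivity

theorem coe_var (N : ℕ) : ((1 / (1 + (N : ℝ≥0)) : ℝ≥0) : ℝ) = 1 / (1 + (N : ℝ)) := by
  push_cast; rfl

/-- The index of an arm whose mean lies below `q` by at least `√2` standard deviations is at most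
`q` with probability at least one half. -/
theorem half_pow_le_prod {m : Fin I → ℕ → ℝ} {g : ℕ → ℕ} (t : ℕ) (i : Fin I) {q : ℚ}
    (hk : ∀ k, k ≠ i → m k (g t) ≤ q ∧
      2 * (1 / (1 + (pathCount a k (g t) : ℝ))) ≤ (q - m k (g t)) ^ 2) :
    ((1 : ℝ) / 2) ^ I ≤ ∏ k ∈ Finset.univ.erase i,
        (gaussianReal (m k (g t)) (1 / (1 + (pathCount a k (g t) : ℝ≥0)))).real
          (Set.Iic (q : ℝ)) := by
  calc ((1 : ℝ) / 2) ^ I ≤ (1 / 2) ^ (Finset.univ.erase i).card :=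
        pow_le_pow_of_le_one (by norm_num) (by norm_num)
          ((Finset.card_le_univ _).trans_eq (Fintype.card_fin I))
    _ = ∏ k ∈ Finset.univ.erase i, (1 : ℝ) / 2 := by rw [Finset.prod_const]
    _ ≤ _ := Finset.prod_le_prod (fun _ _ => by norm_num) fun k hk' => by
        have := hk k (Finset.ne_of_mem_erase hk')
        exact half_le_gaussianReal_real_Iic (var_ne_zero _) this.1 (by rw [coe_var]; exact this.2)

variable [NeZero I] {μ : Fin I → ℝ} {p m : Fin I → ℕ → ℝ} {g : ℕ → ℕ}

namespace IsTypicalPath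

variable (h : IsTypicalPath μ a p m g)
include h

theorem exp_le_prob (t : ℕ) (i : Fin I) {q : ℚ} {D : ℝ}
    (hk : ∀ k, k ≠ i → m k (g t) ≤ q ∧
      2 * (1 / (1 + (pathCount a k (g t) : ℝ))) ≤ (q - m k (g t)) ^ 2)
    (hD : 0 ≤ D) (hi : q - m i (g t) ≤ D) :
    Real.exp (-(D * √(1 + (pathCount a i (g t) : ℝ)) + 1) ^ 2 / 2) / 3 * (1 / 2) ^ I ≤ p i t := by
  refine le_trans ?_ (h.prod_le i t q)
  have h1 := exp_le_gaussianReal_real_Ioi (var_ne_zero (pathCount a i (g t))) hD hi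
  rw [coe_var] at h1
  refine mul_le_mul (le_trans (le_of_eq ?_) h1) (half_pow_le_prod t i hk) (by positivity)
    measureReal_nonneg
  congr 2
  set x : ℝ := 1 + (pathCount a i (g t) : ℝ) with hx
  have hx0 : 0 < x := by positivity
  have h2 : √x ^ 2 = x := Real.sq_sqrt hx0.le
  have h3 : 0 < √x := Real.sqrt_pos.2 hx0
  rw [Real.sqrt_div zero_le_one, Real.sqrt_one]
  have : D + 1 / √x = (D * √x + 1) / √x := by field_simp
  rw [this, div_pow, h2]
  field_simp

end IsTypicalPath

end Pathwise

theorem eventually_log_lt_mul (c C : ℝ) (hc : 0 < c) :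
    ∀ᶠ n : ℕ in atTop, 2 * Real.log (n + 1) + C < c * n := by
  have h1 : (fun x : ℝ => Real.log x) =o[atTop] fun x => x := Real.isLittleO_log_id_atTop
  have h2 : Tendsto (fun n : ℕ => (n : ℝ) + 1) atTop atTop :=
    tendsto_atTop_add_const_right _ _ tendsto_natCast_atTop_atTop
  have h3 := (h1.comp_tendsto h2).def (show 0 < c / 4 by positivity)
  filter_upwards [h3, tendsto_natCast_atTop_atTop.eventually_gt_atTop ((C + c) / (c / 2))]
    with n hn hn2
  rw [div_lt_iff₀ (by positivity)] at hn2
  simp only [Function.comp_apply] at hn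
  rw [Real.norm_of_nonneg (by positivity : (0 : ℝ) ≤ (n : ℝ) + 1)] at hn
  have := le_of_abs_le hn
  linarith

section Pathwise

variable {I : ℕ} {a : ℕ → Fin I} [NeZero I] {μ : Fin I → ℝ} {p m : Fin I → ℕ → ℝ} {g : ℕ → ℕ}

namespace IsTypicalPath

variable (h : IsTypicalPath μ a p m g)
include h

/-- Every arm is pulled infinitely often: otherwise its index keeps a fixed variance, its action
probability stays bounded below, and the number of pulls grows linearly. -/
theorem tendsto_pathCount (i : Fin I) : Tendsto (pathCount a i) atTop atTop := by
  by_contra hcon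
  have hb : ∃ b : ℕ, ∀ n, pathCount a i n ≤ b := by
    by_contra! hb
    exact hcon (tendsto_atTop_atTop_of_monotone (pathCount_mono a i) fun b =>
      (hb b).imp fun _ h => h.le)
  obtain ⟨b, hb⟩ := hb
  choose B hB using h.bounded
  obtain ⟨M, hM⟩ := exists_nat_gt (∑ k, |B k|)
  have hmM : ∀ k n, |m k n| ≤ M := fun k n =>
    (hB k n).trans ((le_abs_self _).trans ((Finset.single_le_sum (f := fun k => |B k|)
      (fun _ _ => abs_nonneg _) (Finset.mem_univ k)).trans hM.le))
  set c : ℝ := Real.exp (-((2 * M + 2) * √(1 + (b : ℝ)) + 1) ^ 2 / 2) / 3 * (1 / 2) ^ I with hc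
  have hc0 : 0 < c := by positivity
  have hp : ∀ t, c ≤ p i t := by
    intro t
    refine le_trans ?_ (h.exp_le_prob t i (q := (M + 2 : ℕ)) (D := 2 * M + 2) ?_ (by positivity) ?_)
    · rw [hc]
      have : (pathCount a i (g t) : ℝ) ≤ b := by exact_mod_cast hb _
      gcongr
    · intro k _
      have h1 := abs_le.1 (hmM k (g t))
      push_cast
      refine ⟨by linarith, ?_⟩
      have h2 : 1 / (1 + (pathCount a k (g t) : ℝ)) ≤ 1 := by
        rw [div_le_one (by positivity)]
        linarith [(pathCount a k (g t)).cast_nonneg (α := ℝ)]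
      nlinarith
    · have h1 := abs_le.1 (hmM i (g t))
      push_cast
      linarith
  obtain ⟨C, hC⟩ := h.accum i
  obtain ⟨n, hn⟩ := (eventually_log_lt_mul (c / 2) (b + C) (by positivity)).exists
  have h1 := hC n
  have h2 : c * n ≤ ∑ t ∈ Finset.range n, p i t := by
    have := Finset.card_nsmul_le_sum (Finset.range n) (p i) c fun t _ => hp t
    rw [Finset.card_range, nsmul_eq_mul] at this
    linarith
  have h3 : (pathCount a i n : ℝ) ≤ b := by exact_mod_cast hb _
  linarith

theorem tendsto_mean (k : Fin I) : Tendsto (fun t => m k (g t)) atTop (𝓝 (μ k)) :=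
  (h.consistent k (h.tendsto_pathCount k)).comp h.tendsto_feedback

theorem eventually_var_le (k : Fin I) {x : ℝ} (hx : x ≠ μ k) :
    ∀ᶠ t in atTop, 2 * (1 / (1 + (pathCount a k (g t) : ℝ))) ≤ (x - m k (g t)) ^ 2 := by
  have h1 : Tendsto (fun t => 2 * (1 / (1 + (pathCount a k (g t) : ℝ)))) atTop (𝓝 (2 * 0)) := by
    refine Tendsto.const_mul 2 ?_
    simp only [one_div]
    exact tendsto_inv_atTop_zero.comp (tendsto_atTop_add_const_left _ _
      (tendsto_natCast_atTop_atTop.comp ((h.tendsto_pathCount k).comp h.tendsto_feedback)))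
  have h2 := ((h.tendsto_mean k).const_sub x).pow 2
  have h3 : 2 * 0 < (x - μ k) ^ 2 := by
    rw [mul_zero]
    have := sub_ne_zero.2 hx
    positivity
  exact (h1.eventually_lt h2 h3).mono fun _ h => h.le

theorem eventually_arm_below (k : Fin I) {x : ℝ} (hx : μ k < x) :
    ∀ᶠ t in atTop, m k (g t) ≤ x ∧
      2 * (1 / (1 + (pathCount a k (g t) : ℝ))) ≤ (x - m k (g t)) ^ 2 :=
  (((h.tendsto_mean k).eventually_lt_const hx).mono fun _ h => h.le).and
    (h.eventually_var_le k hx.ne')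

/-- The best arm is pulled a positive fraction of the time. -/
theorem exists_mul_le_pathCount_zero (hμ : ∀ i : Fin I, i ≠ 0 → μ i < μ 0) :
    ∃ c : ℝ, 0 < c ∧ ∀ᶠ n : ℕ in atTop, c * n ≤ pathCount a 0 n := by
  have h1 : ∀ᶠ x in 𝓝[<] μ 0, ∀ i : Fin I, i ≠ 0 → μ i < x := by
    refine eventually_all.2 fun i => ?_
    by_cases hi : i = 0
    · exact .of_forall fun x h => absurd hi h
    · filter_upwards [Ioo_mem_nhdsLT (hμ i hi)] with x hx _ using hx.1
  obtain ⟨x, hx1, hx2⟩ := (h1.and self_mem_nhdsWithin).exists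
  obtain ⟨q, hq1, hq2⟩ := exists_rat_btwn hx2
  have h2 : ∀ᶠ t in atTop, ∀ k : Fin I, k ≠ 0 → m k (g t) ≤ q ∧
      2 * (1 / (1 + (pathCount a k (g t) : ℝ))) ≤ (q - m k (g t)) ^ 2 := by
    refine eventually_all.2 fun i => ?_
    by_cases hi : i = 0
    · exact .of_forall fun x h => absurd hi h
    · exact (h.eventually_arm_below i ((hx1 i hi).trans hq1)).mono fun _ h _ => h
  have h3 : ∀ᶠ t in atTop, 1 / 2 * (1 / 2 : ℝ) ^ I ≤ p 0 t := by
    filter_upwards [h2, (h.tendsto_mean 0).eventually_const_lt hq2, h.eventually_var_le 0 hq2.ne]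
      with t ht1 ht2 ht3
    refine le_trans ?_ (h.prod_le 0 t q)
    refine mul_le_mul ?_ (half_pow_le_prod t 0 ht1) (by positivity) measureReal_nonneg
    exact half_le_gaussianReal_real_Ioi (var_ne_zero _) ht2.le (by rw [coe_var]; exact ht3)
  set c : ℝ := 1 / 2 * (1 / 2 : ℝ) ^ I with hc
  have hc0 : 0 < c := by positivity
  obtain ⟨t₀, ht₀⟩ := eventually_atTop.1 h3
  obtain ⟨C, hC⟩ := h.accum 0
  refine ⟨c / 4, by positivity, ?_⟩
  filter_upwards [eventually_log_lt_mul (c / 4) (C + c * t₀ / 2) (by positivity)] with n hn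
  have h4 : c * (n - t₀) ≤ ∑ t ∈ Finset.range n, p 0 t := by
    have h5 : ∀ t ∈ Finset.range n, c - (if t < t₀ then c else 0) ≤ p 0 t := fun t _ => by
      split_ifs with hlt
      · simpa using h.nonneg 0 t
      · simpa using ht₀ t (not_lt.1 hlt)
    refine le_trans ?_ (Finset.sum_le_sum h5)
    rw [Finset.sum_sub_distrib, Finset.sum_const, Finset.card_range, nsmul_eq_mul,
      ← Finset.sum_filter, Finset.sum_const, nsmul_eq_mul]
    have : (((Finset.range n).filter (· < t₀)).card : ℝ) ≤ t₀ := by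
      have h6 : (Finset.range n).filter (· < t₀) ⊆ Finset.range t₀ := fun t ht =>
        Finset.mem_range.2 (Finset.mem_filter.1 ht).2
      have := Finset.card_le_card h6
      rw [Finset.card_range] at this
      exact_mod_cast this
    nlinarith
  have := hC n
  linarith

theorem eventually_half_le_feedback : ∀ᶠ t : ℕ in atTop, (t : ℝ) / 2 ≤ g t := by
  obtain ⟨k, hk⟩ := h.growth
  filter_upwards [hk, h.tendsto_feedback.eventually_ge_atTop 1] with t h1 h2
  have h3 : (1 : ℝ) ≤ g t := by exact_mod_cast h2
  have h4 : (g t : ℝ) ^ (1 - 2 / ((k : ℝ) + 2)) ≤ (g t : ℝ) ^ (1 : ℝ) :=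
    Real.rpow_le_rpow_of_exponent_le h3 (by
      have : 0 ≤ 2 / ((k : ℝ) + 2) := by positivity
      linarith)
  rw [Real.rpow_one] at h4
  linarith

/-- A lower bound for the probability of a suboptimal arm, sharp in the exponent. -/
theorem exists_exp_le_prob (hμ : ∀ i : Fin I, i ≠ 0 → μ i < μ 0) {i : Fin I} (hi : i ≠ 0) {δ : ℝ}
    (hδ : 0 < δ) :
    ∃ κ : ℝ, 0 < κ ∧ ∀ᶠ t in atTop,
      κ * Real.exp (-((1 + δ) * ((μ 0 - μ i) ^ 2 / 2) * pathCount a i (g t))) ≤ p i t := by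
  set Δ := μ 0 - μ i with hΔ
  have hΔ0 : 0 < Δ := sub_pos.2 (hμ i hi)
  obtain ⟨D, hD1, hD2⟩ : ∃ D, Δ < D ∧ D ^ 2 < (1 + δ) * Δ ^ 2 := by
    have hcont : Tendsto (fun D : ℝ => D ^ 2) (𝓝[>] Δ) (𝓝 (Δ ^ 2)) :=
      ((continuous_pow 2).tendsto Δ).mono_left nhdsWithin_le_nhds
    have := hcont.eventually_lt_const (show Δ ^ 2 < (1 + δ) * Δ ^ 2 by nlinarith [pow_pos hΔ0 2])
    obtain ⟨D, h1, h2⟩ := (this.and self_mem_nhdsWithin).exists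
    exact ⟨D, h2, h1⟩
  have hD0 : 0 < D := hΔ0.trans hD1
  obtain ⟨q, hq1, hq2⟩ := exists_rat_btwn (show μ 0 < μ i + D by linarith)
  have hk : ∀ᶠ t in atTop, ∀ k : Fin I, k ≠ i → m k (g t) ≤ q ∧
      2 * (1 / (1 + (pathCount a k (g t) : ℝ))) ≤ (q - m k (g t)) ^ 2 := by
    refine eventually_all.2 fun k => ?_
    have : μ k < q := by
      by_cases hk : k = 0
      · rw [hk]; exact hq1
      · exact (hμ k hk).trans hq1
    exact (h.eventually_arm_below k this).mono fun _ h _ => h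
  set η := (1 + δ) * Δ ^ 2 - D ^ 2 with hη
  have hη0 : 0 < η := sub_pos.2 hD2
  -- With `s = √(1 + N)`, the square `(D s + 1) ^ 2` is at most `(1 + δ) Δ² s ^ 2` plus a constant.
  refine ⟨Real.exp (-((1 + δ) * Δ ^ 2 + 1 + D ^ 2 / η) / 2) / 3 * (1 / 2) ^ I, by positivity, ?_⟩
  filter_upwards [hk, (h.tendsto_mean i).eventually_const_lt (show (q : ℝ) - D < μ i by linarith)]
    with t h1 h2
  refine le_trans ?_ (h.exp_le_prob t i h1 hD0.le (by linarith))
  set N : ℝ := (pathCount a i (g t) : ℝ) with hN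
  have hs : √(1 + N) ^ 2 = 1 + N := Real.sq_sqrt (by positivity)
  have h3 : (D * √(1 + N) + 1) ^ 2 ≤ (1 + δ) * Δ ^ 2 * (1 + N) + 1 + D ^ 2 / η := by
    have h4 : 2 * D * √(1 + N) ≤ η * (1 + N) + D ^ 2 / η := by
      have h5 : 0 ≤ (η * √(1 + N) - D) ^ 2 / η := by positivity
      have h6 : (η * √(1 + N) - D) ^ 2 / η = η * √(1 + N) ^ 2 - 2 * D * √(1 + N) + D ^ 2 / η := by
        field_simp; ring
      rw [h6, hs] at h5
      linarith
    have h7 : (D * √(1 + N) + 1) ^ 2 = D ^ 2 * √(1 + N) ^ 2 + 2 * D * √(1 + N) + 1 := by ring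
    rw [h7, hs]
    have : (1 + δ) * Δ ^ 2 = η + D ^ 2 := by rw [hη]; ring
    rw [this]
    linarith
  calc Real.exp (-((1 + δ) * Δ ^ 2 + 1 + D ^ 2 / η) / 2) / 3 * (1 / 2) ^ I *
        Real.exp (-((1 + δ) * (Δ ^ 2 / 2) * N))
      = Real.exp (-((1 + δ) * Δ ^ 2 + 1 + D ^ 2 / η) / 2 + -((1 + δ) * (Δ ^ 2 / 2) * N)) / 3
          * (1 / 2) ^ I := by rw [Real.exp_add]; ring
    _ ≤ Real.exp (-(D * √(1 + N) + 1) ^ 2 / 2) / 3 * (1 / 2) ^ I := by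
        gcongr
        linarith

/-- An upper bound for the probability of a suboptimal arm, sharp in the exponent. -/
theorem eventually_prob_le (hμ : ∀ i : Fin I, i ≠ 0 → μ i < μ 0) {i : Fin I} (hi : i ≠ 0) {δ : ℝ}
    (hδ : 0 < δ) (hδ1 : δ < 1) :
    ∀ᶠ t : ℕ in atTop, p i t ≤
      Real.exp (-((1 - δ) * ((μ 0 - μ i) ^ 2 / 2) * pathCount a i (g t))) + (t : ℝ) ^ (-2 : ℝ) := by
  set Δ := μ 0 - μ i with hΔ
  have hΔ0 : 0 < Δ := sub_pos.2 (hμ i hi)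
  have hd : √(1 - δ) < 1 := by
    rw [Real.sqrt_lt' one_pos]; linarith
  have hdΔ : √(1 - δ) * Δ < Δ := by nlinarith
  obtain ⟨q, hq1, hq2⟩ := exists_rat_btwn (show μ i + √(1 - δ) * Δ < μ 0 by linarith)
  obtain ⟨c, hc0, hc⟩ := h.exists_mul_le_pathCount_zero hμ
  set e := ((μ 0 - q) / 2) ^ 2 with he
  have he0 : 0 < e := by
    have : 0 < (μ 0 - q) / 2 := by linarith
    positivity
  have hexp : ∀ᶠ t : ℕ in atTop, Real.exp (-(e * c / 4) * t) ≤ (t : ℝ) ^ (-2 : ℝ) := by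
    have h1 := (isLittleO_exp_neg_mul_rpow_atTop (show 0 < e * c / 4 by positivity) (-2)).comp_tendsto
      (tendsto_natCast_atTop_atTop (R := ℝ))
    filter_upwards [h1.def one_pos] with t ht
    simpa [Real.norm_of_nonneg (Real.rpow_nonneg (Nat.cast_nonneg t) _)] using ht
  filter_upwards [hexp, h.eventually_half_le_feedback, h.tendsto_feedback.eventually hc,
    (h.tendsto_mean i).eventually_lt_const (show μ i < q - √(1 - δ) * Δ by linarith),
    (h.tendsto_mean 0).eventually_const_lt (show (q + μ 0) / 2 < μ 0 by linarith)]
    with t h1 h2 h3 h4 h5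
  have hsd : 0 ≤ √(1 - δ) * Δ := by positivity
  refine (h.le_add i t q).trans (add_le_add ?_ ?_)
  · refine (gaussianReal_real_Ici_le _ (by linarith)).trans (Real.exp_le_exp.2 ?_)
    rw [coe_var]
    set N : ℝ := (pathCount a i (g t) : ℝ) with hN
    have hN0 : 0 ≤ N := Nat.cast_nonneg _
    have h6 : (√(1 - δ) * Δ) ^ 2 ≤ (q - m i (g t)) ^ 2 :=
      pow_le_pow_left₀ hsd (by linarith) 2
    rw [mul_pow, Real.sq_sqrt (by linarith)] at h6
    have h7 : -(q - m i (g t)) ^ 2 / (2 * (1 / (1 + N))) = -((q - m i (g t)) ^ 2 * (1 + N) / 2) := by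
      field_simp
    rw [h7]
    nlinarith [mul_le_mul_of_nonneg_right h6 hN0, sq_nonneg ((q : ℝ) - m i (g t))]
  · refine (gaussianReal_real_Iic_le _ (by linarith)).trans (le_trans (Real.exp_le_exp.2 ?_) h1)
    rw [coe_var]
    set N : ℝ := (pathCount a 0 (g t) : ℝ) with hN
    have hN0 : 0 ≤ N := Nat.cast_nonneg _
    have h6 : e ≤ (q - m 0 (g t)) ^ 2 := by
      have : ((μ 0 - q) / 2) ^ 2 ≤ (m 0 (g t) - q) ^ 2 :=
        pow_le_pow_left₀ (by linarith) (by linarith) 2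
      rw [he]; linarith [sub_sq_comm (q : ℝ) (m 0 (g t))]
    have h7 : -(q - m 0 (g t)) ^ 2 / (2 * (1 / (1 + N))) = -((q - m 0 (g t)) ^ 2 * (1 + N) / 2) := by
      field_simp
    rw [h7]
    have h8 : c * (t / 2) ≤ 1 + N := by
      have := mul_le_mul_of_nonneg_left h2 hc0.le
      linarith
    have h9 : e * (c * (t / 2)) ≤ (q - m 0 (g t)) ^ 2 * (1 + N) :=
      mul_le_mul h6 h8 (by positivity) (sq_nonneg _)
    linarith

end IsTypicalPath

end Pathwise

/-! ### Pathwise analysis: logarithmic growth of the numbers of pulls -/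

section Growth

variable {I : ℕ} {a : ℕ → Fin I} [NeZero I] {μ : Fin I → ℝ} {p m : Fin I → ℕ → ℝ} {g : ℕ → ℕ}

theorem tendsto_log_natCast : Tendsto (fun n : ℕ => Real.log n) atTop atTop :=
  Real.tendsto_log_atTop.comp tendsto_natCast_atTop_atTop

theorem exp_neg_mul_log {n : ℕ} (hn : 1 ≤ n) (x : ℝ) :
    Real.exp (-(x * Real.log n)) = (n : ℝ) ^ (-x) := by
  rw [Real.rpow_def_of_pos (by exact_mod_cast hn)]
  congr 1
  ring

theorem eventually_le_rpow_nat (C : ℝ) {x : ℝ} (hx : 0 < x) :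
    ∀ᶠ n : ℕ in atTop, C ≤ (n : ℝ) ^ x :=
  ((tendsto_rpow_atTop hx).comp tendsto_natCast_atTop_atTop).eventually_ge_atTop C

theorem eventually_mul_log_lt_rpow_nat (b C : ℝ) {c x : ℝ} (hc : 0 < c) (hx : 0 < x) :
    ∀ᶠ n : ℕ in atTop, b * Real.log n + C < c * (n : ℝ) ^ x := by
  have h1 : (fun n : ℕ => b * Real.log n + C) =o[atTop] fun n : ℕ => (n : ℝ) ^ x := by
    refine (((isLittleO_log_rpow_atTop hx).comp_tendsto
      tendsto_natCast_atTop_atTop).const_mul_left b).add ?_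
    refine Asymptotics.isLittleO_const_left.2 (Or.inr ?_)
    exact tendsto_norm_atTop_atTop.comp
      ((tendsto_rpow_atTop hx).comp tendsto_natCast_atTop_atTop)
  filter_upwards [h1.def (half_pos hc), eventually_ge_atTop 1] with n hn h1
  have h2 : 0 < (n : ℝ) ^ x := Real.rpow_pos_of_pos (by exact_mod_cast h1) _
  rw [Real.norm_of_nonneg h2.le] at hn
  have := le_of_abs_le hn
  nlinarith

namespace IsTypicalPath

variable (h : IsTypicalPath μ a p m g)
include h

/-- Were `N_i(n)` smaller, the accumulated probability of pulling `i` would be a power of `n`. -/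
theorem eventually_log_le_pathCount (hμ : ∀ i : Fin I, i ≠ 0 → μ i < μ 0) {i : Fin I} (hi : i ≠ 0)
    {δ : ℝ} (hδ : 0 < δ) :
    ∀ᶠ n : ℕ in atTop, (1 - δ) * (2 / (μ 0 - μ i) ^ 2) * Real.log n ≤ pathCount a i n := by
  have hΔ0 : 0 < μ 0 - μ i := sub_pos.2 (hμ i hi)
  obtain ⟨κ, hκ0, hκ⟩ := h.exists_exp_le_prob hμ hi hδ
  set Δ := μ 0 - μ i with hΔ
  obtain ⟨t₀, ht₀⟩ := eventually_atTop.1 hκ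
  obtain ⟨C, hC⟩ := h.accum i
  have hδ2 : 0 < δ ^ 2 := by positivity
  filter_upwards [eventually_ge_atTop (2 * t₀), eventually_ge_atTop 1,
    eventually_mul_log_lt_rpow_nat ((1 - δ) * (2 / Δ ^ 2) + 2) (2 * Real.log 2 + C)
      (show 0 < κ / 4 by positivity) hδ2] with n hn0 hn1 hn2
  by_contra! hlt
  have hn1' : (1 : ℝ) ≤ n := by exact_mod_cast hn1
  have h1 : ∀ t ∈ Finset.Ico t₀ n, κ * (n : ℝ) ^ (-(1 - δ ^ 2)) ≤ p i t := by
    intro t ht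
    rw [Finset.mem_Ico] at ht
    refine le_trans ?_ (ht₀ t ht.1)
    rw [← exp_neg_mul_log hn1]
    have h2 : (pathCount a i (g t) : ℝ) ≤ pathCount a i n := by
      exact_mod_cast pathCount_mono a i ((h.feedback_le t).trans ht.2.le)
    have h3 : (1 + δ) * (Δ ^ 2 / 2) * pathCount a i (g t) ≤ (1 - δ ^ 2) * Real.log n := by
      calc (1 + δ) * (Δ ^ 2 / 2) * pathCount a i (g t)
          ≤ (1 + δ) * (Δ ^ 2 / 2) * ((1 - δ) * (2 / Δ ^ 2) * Real.log n) :=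
            mul_le_mul_of_nonneg_left (h2.trans hlt.le) (by positivity)
        _ = (1 - δ ^ 2) * Real.log n := by field_simp; ring
    gcongr
  have h4 := Finset.card_nsmul_le_sum _ _ _ h1
  rw [Nat.card_Ico, nsmul_eq_mul, Nat.cast_sub (by omega)] at h4
  have h5 : ∑ t ∈ Finset.Ico t₀ n, p i t ≤ ∑ t ∈ Finset.range n, p i t :=
    Finset.sum_le_sum_of_subset_of_nonneg
      (fun t ht => Finset.mem_range.2 (Finset.mem_Ico.1 ht).2) fun t _ _ => h.nonneg i t
  have h6 : (n : ℝ) * (n : ℝ) ^ (-(1 - δ ^ 2)) = (n : ℝ) ^ (δ ^ 2) := by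
    rw [mul_comm, ← Real.rpow_add_one (by positivity)]
    congr 1
    ring
  have h7 : (n : ℝ) / 2 ≤ n - t₀ := by
    have : (2 * t₀ : ℝ) ≤ n := by exact_mod_cast hn0
    linarith
  have h8 : (n : ℝ) / 2 * (κ * (n : ℝ) ^ (-(1 - δ ^ 2))) ≤ ∑ t ∈ Finset.range n, p i t :=
    (mul_le_mul_of_nonneg_right h7 (by positivity)).trans (h4.trans h5)
  have h9 : (n : ℝ) / 2 * (κ * (n : ℝ) ^ (-(1 - δ ^ 2))) = κ / 2 * (n : ℝ) ^ (δ ^ 2) := by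
    rw [← h6]; ring
  have h10 : Real.log (n + 1) ≤ Real.log 2 + Real.log n := by
    rw [← Real.log_mul (by norm_num) (by positivity)]
    exact Real.log_le_log (by positivity) (by linarith)
  have := hC n
  linarith

/-- The lower bound on `N_i` forces the probability of pulling `i` below any power `t ^ (-ρ)`
with `ρ < 1`. -/
theorem eventually_prob_le_rpow (hμ : ∀ i : Fin I, i ≠ 0 → μ i < μ 0) {i : Fin I} (hi : i ≠ 0)
    {ρ : ℝ} (hρ0 : 0 ≤ ρ) (hρ : ρ < 1) : ∀ᶠ t : ℕ in atTop, p i t ≤ (t : ℝ) ^ (-ρ) := by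
  have hΔ0 : 0 < μ 0 - μ i := sub_pos.2 (hμ i hi)
  -- With this `δ` one has `(1 - δ) ^ 2 > 1 - 2 * δ > ρ`.
  set δ := (1 - ρ) / 4 with hδ
  have hδ0 : 0 < δ := by rw [hδ]; linarith
  have hδ1 : δ < 1 := by rw [hδ]; linarith
  set ρ' := (1 - δ) * (1 - δ) with hρ'
  have hρρ : 0 < ρ' - ρ := by
    rw [hρ']; nlinarith
  have hρ'1 : ρ' ≤ 1 := by rw [hρ']; nlinarith
  filter_upwards [h.eventually_prob_le hμ hi hδ0 hδ1, h.eventually_half_le_feedback,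
    h.tendsto_feedback.eventually (h.eventually_log_le_pathCount hμ hi hδ0),
    eventually_ge_atTop 1, eventually_le_rpow_nat 3 hρρ] with t h1 h2 h3 h4 h5
  set Δ := μ 0 - μ i with hΔ
  have ht1 : (1 : ℝ) ≤ t := by exact_mod_cast h4
  have hlog : Real.log t - Real.log 2 ≤ Real.log (g t) := by
    rw [← Real.log_div (by positivity) (by norm_num)]
    exact Real.log_le_log (by positivity) h2
  have h6 : ρ' * (Real.log t - Real.log 2) ≤ (1 - δ) * (Δ ^ 2 / 2) * pathCount a i (g t) := by
    calc ρ' * (Real.log t - Real.log 2) ≤ ρ' * Real.log (g t) :=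
          mul_le_mul_of_nonneg_left hlog (by linarith)
      _ = (1 - δ) * (Δ ^ 2 / 2) * ((1 - δ) * (2 / Δ ^ 2) * Real.log (g t)) := by
          rw [hρ']; field_simp
      _ ≤ _ := mul_le_mul_of_nonneg_left h3 (mul_nonneg (by linarith) (by positivity))
  have h7 : Real.exp (-((1 - δ) * (Δ ^ 2 / 2) * pathCount a i (g t))) ≤ 2 * (t : ℝ) ^ (-ρ') := by
    calc _ ≤ Real.exp (Real.log 2 + -(ρ' * Real.log t)) := by
          refine Real.exp_le_exp.2 ?_
          have : ρ' * Real.log 2 ≤ Real.log 2 :=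
            mul_le_of_le_one_left (Real.log_nonneg one_le_two) hρ'1
          linarith
      _ = 2 * (t : ℝ) ^ (-ρ') := by
          rw [Real.exp_add, Real.exp_log two_pos, exp_neg_mul_log h4]
  have h8 : (t : ℝ) ^ (-2 : ℝ) ≤ (t : ℝ) ^ (-ρ') :=
    Real.rpow_le_rpow_of_exponent_le ht1 (by linarith)
  calc p i t ≤ 3 * (t : ℝ) ^ (-ρ') := by linarith
    _ ≤ (t : ℝ) ^ (ρ' - ρ) * (t : ℝ) ^ (-ρ') := by gcongr
    _ = (t : ℝ) ^ (-ρ) := by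
        rw [← Real.rpow_add (by positivity)]
        congr 1
        ring

/-- If arm `i` still has a probability above `t ^ (-(1 + κ))`, then it has not been pulled much more
than `(2 / Δ ^ 2) log t` times. -/
theorem exists_eventually_pathCount_le (hμ : ∀ i : Fin I, i ≠ 0 → μ i < μ 0) {i : Fin I}
    (hi : i ≠ 0) {δ : ℝ} (hδ : 0 < δ) :
    ∃ k : ℕ, ∀ᶠ t : ℕ in atTop, (t : ℝ) ^ (-(1 + 1 / ((k : ℝ) + 1))) < p i t →
      pathCount a i (g t) ≤ (1 + δ) * (2 / (μ 0 - μ i) ^ 2) * Real.log t := by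
  have hΔ0 : 0 < μ 0 - μ i := sub_pos.2 (hμ i hi)
  obtain ⟨k, hk⟩ := exists_nat_one_div_lt (show 0 < min (δ / 4) (1 / 2) by positivity)
  set κ : ℝ := 1 / ((k : ℝ) + 1) with hκ
  have hκ0 : 0 < κ := by positivity
  have hκ1 : κ < δ / 4 := hk.trans_le (min_le_left _ _)
  have hκ2 : κ < 1 / 2 := hk.trans_le (min_le_right _ _)
  -- `δ'` solves `(1 + δ) * (1 - δ') = 1 + δ / 2`, which exceeds `1 + 2 * κ`.
  set δ' := δ / (2 * (1 + δ)) with hδ'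
  have hδ'0 : 0 < δ' := by positivity
  have hδ'1 : δ' < 1 := by
    rw [hδ', div_lt_one (by positivity)]; linarith
  have hδδ : (1 + δ) * (1 - δ') = 1 + δ / 2 := by
    rw [hδ']; field_simp; ring
  refine ⟨k, ?_⟩
  filter_upwards [h.eventually_prob_le hμ hi hδ'0 hδ'1, eventually_ge_atTop 1,
    eventually_le_rpow_nat 2 hκ0, eventually_le_rpow_nat 2 (show 0 < 1 - κ by linarith)]
    with t h1 h2 h3 h4 h5
  set Δ := μ 0 - μ i with hΔ
  have ht1 : (1 : ℝ) ≤ t := by exact_mod_cast h2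
  have ht0 : (0 : ℝ) < t := by linarith
  set N : ℝ := (pathCount a i (g t) : ℝ) with hN
  have e1 : (t : ℝ) ^ (κ : ℝ) * (t : ℝ) ^ (-(1 + 2 * κ)) = (t : ℝ) ^ (-(1 + κ)) := by
    rw [← Real.rpow_add ht0]; congr 1; ring
  have e2 : (t : ℝ) ^ (1 - κ) * (t : ℝ) ^ (-2 : ℝ) = (t : ℝ) ^ (-(1 + κ)) := by
    rw [← Real.rpow_add ht0]; congr 1; ring
  have p1 : 0 < (t : ℝ) ^ (-(1 + 2 * κ)) := Real.rpow_pos_of_pos ht0 _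
  have p2 : 0 < (t : ℝ) ^ (-2 : ℝ) := Real.rpow_pos_of_pos ht0 _
  have h6 : Real.exp (-((1 + 2 * κ) * Real.log t)) < Real.exp (-((1 - δ') * (Δ ^ 2 / 2) * N)) := by
    rw [exp_neg_mul_log h2]
    have := mul_le_mul_of_nonneg_right h3 p1.le
    have := mul_le_mul_of_nonneg_right h4 p2.le
    linarith
  rw [Real.exp_lt_exp, neg_lt_neg_iff] at h6
  have hlog : 0 ≤ Real.log t := Real.log_nonneg ht1
  have h7 : (1 - δ') * (Δ ^ 2 / 2) * N ≤ (1 - δ') * (1 + δ) * Real.log t := by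
    rw [mul_comm (1 - δ') (1 + δ), hδδ]
    nlinarith
  have h8 : Δ ^ 2 / 2 * N ≤ (1 + δ) * Real.log t := by
    have : 0 < 1 - δ' := by linarith
    refine le_of_mul_le_mul_left ?_ this
    linarith
  calc N = 2 / Δ ^ 2 * (Δ ^ 2 / 2 * N) := by field_simp
    _ ≤ 2 / Δ ^ 2 * ((1 + δ) * Real.log t) := mul_le_mul_of_nonneg_left h8 (by positivity)
    _ = _ := by ring

/-- The pulls before time `n` are those before the last feedback preceding the last round in which
`i` has a substantial probability, those in the batch of that round, and those after it. -/
theorem eventually_pathCount_le_log (hμ : ∀ i : Fin I, i ≠ 0 → μ i < μ 0) {i : Fin I} (hi : i ≠ 0)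
    {δ ε : ℝ} (hδ : 0 < δ) (hε : 0 < ε) :
    ∀ᶠ n : ℕ in atTop, pathCount a i n ≤
      ((1 + δ) * (2 / (μ 0 - μ i) ^ 2) + 2 * ε) * Real.log n := by
  have hΔ0 : 0 < μ 0 - μ i := sub_pos.2 (hμ i hi)
  obtain ⟨k, hk⟩ := h.exists_eventually_pathCount_le hμ hi hδ
  obtain ⟨k', hk'⟩ := h.growth
  have hρ : 1 / ((k' : ℝ) + 2) ≤ 1 := by
    rw [div_le_one (by positivity)]
    linarith [k'.cast_nonneg (α := ℝ)]
  obtain ⟨t₂, ht₂⟩ := eventually_atTop.1 (h.eventually_prob_le_rpow hμ hi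
    (ρ := 1 - 1 / ((k' : ℝ) + 2)) (by linarith) (sub_lt_self _ (by positivity)))
  obtain ⟨t₁, ht₁⟩ := eventually_atTop.1 (hk.and (hk'.and
    ((h.tendsto_feedback.eventually (h.window i k' ε hε)).and
      (h.tendsto_feedback.eventually_ge_atTop (max t₂ 1)))))
  filter_upwards [h.rare i k ε hε, tendsto_log_natCast.eventually_ge_atTop (t₁ / ε),
    eventually_ge_atTop 1] with n hn hn1 hn2
  rw [div_le_iff₀ hε] at hn1
  have hlog : 0 ≤ Real.log n := Real.log_natCast_nonneg n
  have hcoef : 0 ≤ (1 + δ) * (2 / (μ 0 - μ i) ^ 2) := by positivity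
  set R := (Finset.range n).filter fun t =>
      a t = i ∧ p i t ≤ (t : ℝ) ^ (-(1 + 1 / ((k : ℝ) + 1))) with hR
  -- `G` collects the late rounds in which arm `i` still has a substantial probability; after the
  -- last of them, arm `i` is pulled in rounds of `R` only.
  set G := (Finset.range n).filter fun t =>
      t₁ ≤ t ∧ (t : ℝ) ^ (-(1 + 1 / ((k : ℝ) + 1))) < p i t with hG
  rcases G.eq_empty_or_nonempty with hGe | hGne
  · have hsub : (Finset.range n).filter (fun s => a s = i) ⊆ Finset.range t₁ ∪ R := by
      intro t ht
      rw [Finset.mem_filter] at ht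
      rw [Finset.mem_union, Finset.mem_range]
      by_cases htt : t < t₁
      · exact Or.inl htt
      · refine Or.inr (Finset.mem_filter.2 ⟨ht.1, ht.2, ?_⟩)
        by_contra! hlt
        have : t ∈ G := Finset.mem_filter.2 ⟨ht.1, not_lt.1 htt, hlt⟩
        simp [hGe] at this
    have h1 := (Finset.card_le_card hsub).trans (Finset.card_union_le _ _)
    rw [Finset.card_range] at h1
    have h2 : (pathCount a i n : ℝ) ≤ t₁ + R.card := by exact_mod_cast h1
    nlinarith [mul_nonneg hcoef hlog]
  · set s := G.max' hGne with hs
    have hsG : s ∈ G := G.max'_mem hGne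
    rw [hG, Finset.mem_filter, Finset.mem_range] at hsG
    obtain ⟨hsn, hst, hsp⟩ := hsG
    obtain ⟨b1, b2, b3, b4⟩ := ht₁ s hst
    set W := (Finset.Icc (g s) (g s + ⌊(g s : ℝ) ^ (1 - 2 / ((k' : ℝ) + 2))⌋₊)).filter fun t =>
      a t = i ∧ p i t ≤ (t : ℝ) ^ (-(1 - 1 / ((k' : ℝ) + 2))) with hW
    have hsub : (Finset.range n).filter (fun s => a s = i) ⊆
        ((Finset.range (g s)).filter (fun s => a s = i) ∪ W) ∪ R := by
      intro t ht
      rw [Finset.mem_filter, Finset.mem_range] at ht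
      rw [Finset.mem_union, Finset.mem_union]
      by_cases h1 : t < g s
      · exact Or.inl (Or.inl (Finset.mem_filter.2 ⟨Finset.mem_range.2 h1, ht.2⟩))
      rw [not_lt] at h1
      by_cases h2 : t ≤ s
      · refine Or.inl (Or.inr (Finset.mem_filter.2 ⟨Finset.mem_Icc.2 ⟨h1, ?_⟩, ht.2,
          ht₂ t ((le_max_left _ _).trans (b4.trans h1))⟩))
        refine h2.trans ?_
        have h3 : ((s - g s : ℕ) : ℝ) ≤ (g s : ℝ) ^ (1 - 2 / ((k' : ℝ) + 2)) := by
          rw [Nat.cast_sub (h.feedback_le s)]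
          linarith
        have := Nat.le_floor h3
        omega
      · refine Or.inr (Finset.mem_filter.2 ⟨Finset.mem_range.2 ht.1, ht.2, ?_⟩)
        by_contra! hlt
        have : t ∈ G := Finset.mem_filter.2 ⟨Finset.mem_range.2 ht.1, by omega, hlt⟩
        have := G.le_max' t this
        omega
    have h1 := ((Finset.card_le_card hsub).trans (Finset.card_union_le _ _)).trans
      (Nat.add_le_add_right (Finset.card_union_le _ _) _)
    have h2 : (pathCount a i n : ℝ) ≤ pathCount a i (g s) + W.card + R.card := by
      exact_mod_cast h1
    have hg1 : 1 ≤ g s := (le_max_right _ _).trans b4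
    have hgs := h.feedback_le s
    have h3 : Real.log (g s) ≤ Real.log n :=
      Real.log_le_log (by exact_mod_cast hg1) (by exact_mod_cast hgs.trans hsn.le)
    have h4 : Real.log s ≤ Real.log n :=
      Real.log_le_log (by exact_mod_cast hg1.trans hgs) (by exact_mod_cast hsn.le)
    have h5 := b1 hsp
    nlinarith [mul_le_mul_of_nonneg_left h4 hcoef, mul_le_mul_of_nonneg_left h3 hε.le]

/-- A suboptimal arm is pulled `(2 / Δ ^ 2) log n` times, asymptotically. -/
theorem tendsto_pathCount_div_log (hμ : ∀ i : Fin I, i ≠ 0 → μ i < μ 0) {i : Fin I} (hi : i ≠ 0) :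
    Tendsto (fun n : ℕ => pathCount a i n / Real.log n) atTop (𝓝 (2 / (μ 0 - μ i) ^ 2)) := by
  have hΔ0 : 0 < μ 0 - μ i := sub_pos.2 (hμ i hi)
  set c := 2 / (μ 0 - μ i) ^ 2 with hc
  have hc0 : 0 < c := by positivity
  refine tendsto_order.2 ⟨fun x hx => ?_, fun x hx => ?_⟩
  · set δ := min (1 / 2) ((c - x) / (2 * c)) with hδ
    have hδ0 : 0 < δ := lt_min (by norm_num) (div_pos (sub_pos.2 hx) (by positivity))
    have hδx : x < (1 - δ) * c := by
      have := min_le_right (1 / 2) ((c - x) / (2 * c))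
      rw [← hδ, le_div_iff₀ (by positivity)] at this
      nlinarith
    filter_upwards [h.eventually_log_le_pathCount hμ hi hδ0,
      tendsto_log_natCast.eventually_gt_atTop 0] with n h1 h2
    exact hδx.trans_le ((le_div_iff₀ h2).2 h1)
  · have hδ0 : 0 < (x - c) / (4 * c) := div_pos (sub_pos.2 hx) (by positivity)
    filter_upwards [h.eventually_pathCount_le_log hμ hi hδ0 (show 0 < (x - c) / 8 by linarith),
      tendsto_log_natCast.eventually_gt_atTop 0] with n h1 h2
    refine ((div_le_iff₀ h2).2 h1).trans_lt ?_
    rw [← hc]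
    have : (1 + (x - c) / (4 * c)) * c = c + (x - c) / 4 := by field_simp
    rw [this]
    linarith

end IsTypicalPath

end Growth

/-! ### Batches -/

section Batches

variable {Ω : Type*} {T : ℕ → Ω → ℕ} {ω : Ω}

theorem lastFeedback_le (h0 : T 0 ω = 0) (t : ℕ) : lastFeedback T t ω ≤ t :=
  Nat.findGreatest_spec (P := fun j => T j ω ≤ t) t.zero_le (by simp [h0])

theorem lt_next_feedback (hmono : StrictMono fun j => T j ω) (t : ℕ) :
    t < T (batchIndex T t ω + 1) ω := by
  by_contra! hle
  have h1 : batchIndex T t ω + 1 ≤ t := (hmono.le_apply (x := batchIndex T t ω + 1)).trans hle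
  exact Nat.findGreatest_is_greatest (P := fun j => T j ω ≤ t) (Nat.lt_succ_self _) h1 hle

theorem tendsto_batchIndex (hmono : StrictMono fun j => T j ω) :
    Tendsto (fun t => batchIndex T t ω) atTop atTop := by
  refine tendsto_atTop.2 fun j => ?_
  filter_upwards [eventually_ge_atTop (T j ω)] with t ht
  exact Nat.le_findGreatest ((hmono.le_apply (x := j)).trans ht) ht

theorem exists_eventually_le_lastFeedback (hmono : StrictMono fun j => T j ω)
    (hg : limsup (fun j : ℕ =>
      ((Real.logb (T j ω : ℝ) ((T (j + 1) ω : ℝ) - (T j ω : ℝ)) : ℝ) : EReal)) atTop < 1) :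
    ∃ k : ℕ, ∀ᶠ t : ℕ in atTop, (t : ℝ) ≤ lastFeedback T t ω +
      (lastFeedback T t ω : ℝ) ^ (1 - 2 / ((k : ℝ) + 2)) := by
  obtain ⟨r, hr1, hr2⟩ := EReal.lt_iff_exists_real_btwn.1 hg
  have hr2' : r < 1 := by exact_mod_cast hr2
  obtain ⟨k, hk⟩ := exists_nat_one_div_lt (show 0 < (1 - r) / 2 by linarith)
  have hk' : 2 / ((k : ℝ) + 2) ≤ 1 - r := by
    have : 1 / ((k : ℝ) + 2) ≤ 1 / ((k : ℝ) + 1) := by gcongr; norm_num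
    have e : 2 / ((k : ℝ) + 2) = 2 * (1 / ((k : ℝ) + 2)) := by ring
    linarith
  refine ⟨k, ?_⟩
  have h1 : ∀ᶠ j : ℕ in atTop,
      (T (j + 1) ω : ℝ) - T j ω ≤ (T j ω : ℝ) ^ (1 - 2 / ((k : ℝ) + 2)) := by
    filter_upwards [eventually_lt_of_limsup_lt hr1, eventually_ge_atTop 2] with j hj hj2
    have hj' : Real.logb (T j ω : ℝ) ((T (j + 1) ω : ℝ) - (T j ω : ℝ)) < r := by exact_mod_cast hj
    have hT : (2 : ℝ) ≤ T j ω := by exact_mod_cast hj2.trans (hmono.le_apply (x := j))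
    have hlt : (T j ω : ℝ) < T (j + 1) ω := by exact_mod_cast hmono j.lt_succ_self
    rw [Real.logb_lt_iff_lt_rpow (by linarith) (by linarith)] at hj'
    exact hj'.le.trans (Real.rpow_le_rpow_of_exponent_le (by linarith) (by linarith))
  filter_upwards [(tendsto_batchIndex hmono).eventually h1] with t ht
  have h2 : (t : ℝ) ≤ T (batchIndex T t ω + 1) ω := by
    exact_mod_cast (lt_next_feedback hmono t).le
  rw [lastFeedback]
  linarith

end Batches

/-! ### Almost every trajectory is typical -/

section Typical

/-- Over a window of length `n ^ (1 - 2 a)`, the thresholds `t ^ (-(1 - a))` sum to `O(1)`. -/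
theorem sum_window_le (k : ℕ) (n : ℕ) :
    ∑ t ∈ Finset.Icc n (n + ⌊(n : ℝ) ^ (1 - 2 / ((k : ℝ) + 2))⌋₊),
      |(t : ℝ) ^ (-(1 - 1 / ((k : ℝ) + 2)))| ≤ 2 := by
  set x : ℝ := 1 / ((k : ℝ) + 2) with hx
  have hx0 : 0 < x := by positivity
  have hx1 : x ≤ 1 / 2 := by
    rw [hx]
    gcongr
    linarith [k.cast_nonneg (α := ℝ)]
  have e : 2 / ((k : ℝ) + 2) = 2 * x := by rw [hx]; ring
  rw [e]
  rcases n.eq_zero_or_pos with rfl | hn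
  · have hu : ∀ t ∈ Finset.Icc 0 (0 + ⌊((0 : ℕ) : ℝ) ^ (1 - 2 * x)⌋₊),
        |(t : ℝ) ^ (-(1 - x))| ≤ 1 := fun t _ => by
      rcases t.eq_zero_or_pos with rfl | ht
      · rw [Nat.cast_zero, Real.zero_rpow (by linarith), abs_zero]
        exact zero_le_one
      · rw [abs_of_nonneg (by positivity)]
        exact Real.rpow_le_one_of_one_le_of_nonpos (by exact_mod_cast ht) (by linarith)
    refine (Finset.sum_le_card_nsmul _ _ _ hu).trans ?_
    have hf : ⌊((0 : ℕ) : ℝ) ^ (1 - 2 * x)⌋₊ ≤ 1 := by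
      refine Nat.floor_le_one_of_le_one ?_
      rw [Nat.cast_zero]
      exact Real.zero_rpow_le_one _
    rw [Nat.card_Icc, nsmul_eq_mul, mul_one]
    have : 0 + ⌊((0 : ℕ) : ℝ) ^ (1 - 2 * x)⌋₊ + 1 - 0 ≤ 2 := by omega
    exact_mod_cast this
  · have hn1 : (1 : ℝ) ≤ n := by exact_mod_cast hn
    have hu : ∀ t ∈ Finset.Icc n (n + ⌊(n : ℝ) ^ (1 - 2 * x)⌋₊),
        |(t : ℝ) ^ (-(1 - x))| ≤ (n : ℝ) ^ (-(1 - x)) := fun t ht => by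
      rw [abs_of_nonneg (by positivity)]
      exact Real.rpow_le_rpow_of_nonpos (by linarith)
        (by exact_mod_cast (Finset.mem_Icc.1 ht).1) (by linarith)
    refine (Finset.sum_le_card_nsmul _ _ _ hu).trans ?_
    rw [Nat.card_Icc, nsmul_eq_mul]
    have h1 : ((n + ⌊(n : ℝ) ^ (1 - 2 * x)⌋₊ + 1 - n : ℕ) : ℝ) ≤ 2 * (n : ℝ) ^ (1 - 2 * x) := by
      have e1 : n + ⌊(n : ℝ) ^ (1 - 2 * x)⌋₊ + 1 - n = ⌊(n : ℝ) ^ (1 - 2 * x)⌋₊ + 1 := by omega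
      rw [e1]
      push_cast
      have h2 := Nat.floor_le (show 0 ≤ (n : ℝ) ^ (1 - 2 * x) by positivity)
      have h3 : 1 ≤ (n : ℝ) ^ (1 - 2 * x) := Real.one_le_rpow hn1 (by linarith)
      linarith
    calc _ ≤ 2 * (n : ℝ) ^ (1 - 2 * x) * (n : ℝ) ^ (-(1 - x)) := by gcongr
      _ = 2 * (n : ℝ) ^ (-x) := by
          rw [mul_assoc, ← Real.rpow_add (by linarith)]
          congr 2
          ring
      _ ≤ 2 := by
          have := Real.rpow_le_one_of_one_le_of_nonpos hn1 (show -x ≤ 0 by linarith)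
          linarith

variable {Ω : Type*} {I : ℕ} {Y θ : Fin I → ℕ → Ω → ℝ} {A : ℕ → Ω → Fin I} {T : ℕ → Ω → ℕ}
  {μ : Fin I → ℝ}

theorem sum_ite_eq_add (i k : Fin I) (n : ℕ) (ω : Ω) :
    (∑ t ∈ Finset.range n, if A t ω = i then Y k t ω else 0) =
      (∑ t ∈ Finset.range n, if A t ω = i then Y k t ω - μ k else 0) +
        μ k * pullCount A i n ω := by
  rw [pullCount, Finset.card_filter, Nat.cast_sum, Finset.mul_sum, ← Finset.sum_add_distrib]
  refine Finset.sum_congr rfl fun t _ => ?_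
  split_ifs <;> simp

theorem postMean_eq (i : Fin I) (n : ℕ) (ω : Ω) :
    postMean Y A i n ω = (∑ t ∈ Finset.range n, if A t ω = i then Y i t ω - μ i else 0) /
      (1 + (pullCount A i n ω : ℝ)) + μ i * (1 - 1 / (1 + (pullCount A i n ω : ℝ))) := by
  rw [postMean, sum_ite_eq_add (μ := μ)]
  have : (1 + (pullCount A i n ω : ℝ)) ≠ 0 := by positivity
  field_simp
  ring

variable [mΩ : MeasurableSpace Ω] {P : Measure Ω} [IsProbabilityMeasure P]

/-- The centred rewards of arm `k` over the rounds in which arm `i` is played are negligible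
compared with the number of these rounds. -/
theorem ae_selected_sum (hY : IsRewardModel P Y μ) (h : IsThompsonSampling P Y θ A T)
    (i k : Fin I) :
    ∀ᵐ ω ∂P, (∃ B : ℝ, ∀ n, |(∑ t ∈ Finset.range n, if A t ω = i then Y k t ω - μ k else 0)| ≤
        B * (1 + (pullCount A i n ω : ℝ))) ∧
      (Tendsto (fun n => pullCount A i n ω) atTop atTop →
        Tendsto (fun n => (∑ t ∈ Finset.range n, if A t ω = i then Y k t ω - μ k else 0) /
          (1 + (pullCount A i n ω : ℝ))) atTop (𝓝 0)) := by
  filter_upwards [ae_exists_tendsto_selected hY h i k] with ω ⟨ℓ, hℓ⟩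
  have hpos : ∀ n, (0 : ℝ) < 1 + (pullCount A i n ω : ℝ) := fun n => by positivity
  have hmono : Monotone fun n => 1 + (pullCount A i n ω : ℝ) := fun n n' hn => by
    have := pathCount_mono (fun s => A s ω) i hn
    exact add_le_add_right (Nat.cast_le.2 this) 1
  exact ⟨exists_abs_sum_le_of_tendsto hpos hmono hℓ, fun htop => tendsto_sum_div_of_tendsto hpos
    hmono (tendsto_atTop_add_const_left _ _ (tendsto_natCast_atTop_atTop.comp htop)) hℓ⟩

theorem ae_postMean (hY : IsRewardModel P Y μ) (h : IsThompsonSampling P Y θ A T) (i : Fin I) :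
    ∀ᵐ ω ∂P, (∃ B : ℝ, ∀ n, |postMean Y A i n ω| ≤ B) ∧
      (Tendsto (fun n => pullCount A i n ω) atTop atTop →
        Tendsto (fun n => postMean Y A i n ω) atTop (𝓝 (μ i))) := by
  filter_upwards [ae_selected_sum hY h i i] with ω ⟨⟨B, hB⟩, hlim⟩
  refine ⟨⟨B + |μ i|, fun n => ?_⟩, fun htop => ?_⟩
  · rw [postMean_eq (μ := μ)]
    have hpos : (0 : ℝ) < 1 + (pullCount A i n ω : ℝ) := by positivity
    have h2 : 1 / (1 + (pullCount A i n ω : ℝ)) ≤ 1 := by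
      rw [div_le_one hpos]
      linarith [(pullCount A i n ω).cast_nonneg (α := ℝ)]
    have h3 : 0 ≤ 1 / (1 + (pullCount A i n ω : ℝ)) := by positivity
    refine (abs_add_le _ _).trans (add_le_add ?_ ?_)
    · rw [abs_div, abs_of_pos hpos, div_le_iff₀ hpos]
      exact hB n
    · rw [abs_mul]
      exact mul_le_of_le_one_right (abs_nonneg _) (abs_le.2 ⟨by linarith, by linarith⟩)
  · simp_rw [postMean_eq (μ := μ)]
    have h1 : Tendsto (fun n => 1 / (1 + (pullCount A i n ω : ℝ))) atTop (𝓝 0) := by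
      simp only [one_div]
      exact tendsto_inv_atTop_zero.comp (tendsto_atTop_add_const_left _ _
        (tendsto_natCast_atTop_atTop.comp htop))
    simpa using (hlim htop).add ((h1.const_sub 1).const_mul (μ i))

theorem ae_isTypicalPath [NeZero I] (hY : IsRewardModel P Y μ) (h : IsThompsonSampling P Y θ A T)
    (hT : IsAdversarialBatching Y A T)
    (hgrowth : ∀ᵐ ω ∂P, limsup (fun j : ℕ =>
      ((Real.logb (T j ω : ℝ) ((T (j + 1) ω : ℝ) - (T j ω : ℝ)) : ℝ) : EReal)) atTop < 1) :
    ∀ᵐ ω ∂P, IsTypicalPath μ (fun t => A t ω) (fun i t => actionProb P Y θ A i t ω)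
      (fun i n => postMean Y A i n ω) (fun t => lastFeedback T t ω) := by
  set ℱ := pastFiltration hY.measurable h.measurable_index h.measurable_arm with hℱ
  have hs : ∀ i t, MeasurableSet[ℱ (t + 1)] (A t ⁻¹' {i}) := fun i t =>
    (measurable_snd.comp (measurable_snd.comp (measurable_past_last t))) (measurableSet_singleton i)
  have h1 : ∀ᵐ ω ∂P, ∀ i t, 0 ≤ actionProb P Y θ A i t ω :=
    ae_all_iff.2 fun i => ae_all_iff.2 fun t =>
      (condExp_indicator_one_mem_Icc (ℱ.le t) (ℱ.le _ _ (hs i t))).mono fun _ h => h.1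
  have h2 := ae_all_iff.2 fun i => ae_sum_condExp_le (P := P) ℱ (hs i)
  have h3 := ae_all_iff.2 fun i => ae_all_iff.2 fun k : ℕ =>
    ae_card_filter_le_mul_log (P := P) ℱ (hs i) (fun n => Finset.range n)
      (u := fun t => (t : ℝ) ^ (-(1 + 1 / ((k : ℝ) + 1))))
      (D := ∑' t : ℕ, |(t : ℝ) ^ (-(1 + 1 / ((k : ℝ) + 1)))|) fun n =>
        Summable.sum_le_tsum _ (fun _ _ => abs_nonneg _)
          ((Real.summable_nat_rpow.2 (by
            have : 0 < 1 / ((k : ℝ) + 1) := by positivity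
            linarith)).abs)
  have h4 := ae_all_iff.2 fun i => ae_all_iff.2 fun k : ℕ =>
    ae_card_filter_le_mul_log (P := P) ℱ (hs i)
      (fun n => Finset.Icc n (n + ⌊(n : ℝ) ^ (1 - 2 / ((k : ℝ) + 2))⌋₊))
      (u := fun t => (t : ℝ) ^ (-(1 - 1 / ((k : ℝ) + 2)))) (D := 2) (sum_window_le k)
  have h5 := ae_all_iff.2 fun i => ae_postMean hY h i
  have h6 := ae_all_iff.2 fun i => ae_all_iff.2 fun t => ae_all_iff.2 fun q : ℚ =>
    h.ae_prod_le_actionProb i t q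
  have h7 := ae_all_iff.2 fun i => ae_all_iff.2 fun t => ae_all_iff.2 fun q : ℚ =>
    h.ae_actionProb_le i t q
  filter_upwards [h1, h2, h3, h4, h5, h6, h7, hgrowth] with ω h1 h2 h3 h4 h5 h6 h7 h8
  refine ⟨h1, fun i => ?_, fun i k ε hε => ?_, fun i k ε hε => ?_, fun i => (h5 i).1,
    fun i => (h5 i).2, h6, h7, fun t => lastFeedback_le (hT.zero ω) t, ?_,
    exists_eventually_le_lastFeedback (hT.strictMono ω) h8⟩
  · obtain ⟨C, hC⟩ := h2 i
    refine ⟨C, fun n => ?_⟩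
    have := hC n
    rw [sum_indicator_eq_pullCount] at this
    exact this
  · filter_upwards [h3 i k ε hε] with n hn
    convert hn <;> rfl
  · filter_upwards [h4 i k ε hε] with n hn
    convert hn <;> rfl
  · exact (hT.strictMono ω).tendsto_atTop.comp (tendsto_batchIndex (hT.strictMono ω))

end Typical

/-! ### The regret -/

/-- The regret is the sum of the gaps times the numbers of pulls, plus centred selected rewards. -/
theorem regret_eq_sum {Ω : Type*} {I : ℕ} [NeZero I] (Y : Fin I → ℕ → Ω → ℝ) (A : ℕ → Ω → Fin I)
    (μ : Fin I → ℝ) (n : ℕ) (ω : Ω) :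
    regret Y A n ω = ∑ i ∈ Finset.univ.filter (fun i : Fin I => i ≠ 0),
      ((∑ t ∈ Finset.range n, if A t ω = i then Y 0 t ω - μ 0 else 0) -
        (∑ t ∈ Finset.range n, if A t ω = i then Y i t ω - μ i else 0) +
        (μ 0 - μ i) * pullCount A i n ω) := by
  have h1 : ∀ t, Y 0 t ω - Y (A t ω) t ω = ∑ i ∈ Finset.univ.filter (fun i : Fin I => i ≠ 0),
      if A t ω = i then Y 0 t ω - Y i t ω else 0 := by
    intro t
    rw [Finset.sum_ite_eq]
    by_cases h : A t ω = 0 <;> simp [h]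
  rw [regret, Finset.sum_congr rfl fun t _ => h1 t, Finset.sum_comm]
  refine Finset.sum_congr rfl fun i _ => ?_
  have h2 := sum_ite_eq_add (Y := Y) (A := A) (μ := μ) i 0 n ω
  have h3 := sum_ite_eq_add (Y := Y) (A := A) (μ := μ) i i n ω
  have h4 : ∑ t ∈ Finset.range n, (if A t ω = i then Y 0 t ω - Y i t ω else 0) =
      (∑ t ∈ Finset.range n, if A t ω = i then Y 0 t ω else 0) -
        ∑ t ∈ Finset.range n, if A t ω = i then Y i t ω else 0 := by
    rw [← Finset.sum_sub_distrib]
    refine Finset.sum_congr rfl fun t _ => ?_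
    split_ifs <;> simp
  rw [h4, h2, h3]
  ring

end BatchedBandit

theorem theorem1 {Ω : Type*} [MeasurableSpace Ω] (P : Measure Ω) [IsProbabilityMeasure P]
    {I : ℕ} [NeZero I] (Y θ : Fin I → ℕ → Ω → ℝ) (A : ℕ → Ω → Fin I) (T : ℕ → Ω → ℕ)
    (μ : Fin I → ℝ)
    (hY : BatchedBandit.IsRewardModel P Y μ)
    (hμ : ∀ i : Fin I, i ≠ 0 → μ i < μ 0)
    (hTS : BatchedBandit.IsThompsonSampling P Y θ A T)
    (hT : BatchedBandit.IsAdversarialBatching Y A T)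
    (hgrowth : ∀ᵐ ω ∂P, limsup (fun j : ℕ =>
      ((Real.logb (T j ω : ℝ) ((T (j + 1) ω : ℝ) - (T j ω : ℝ)) : ℝ) : EReal)) atTop < 1) :
    ∀ᵐ ω ∂P, Tendsto (fun n : ℕ => BatchedBandit.regret Y A n ω / Real.log (n : ℝ)) atTop
      (𝓝 (∑ i ∈ Finset.univ.filter (fun i : Fin I => i ≠ 0), 2 / (μ 0 - μ i))) := by
  have hsel := ae_all_iff.2 fun i => ae_all_iff.2 fun k =>
    BatchedBandit.ae_selected_sum hY hTS i k
  filter_upwards [BatchedBandit.ae_isTypicalPath hY hTS hT hgrowth, hsel] with ω hω hsel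
  simp_rw [BatchedBandit.regret_eq_sum Y A μ, Finset.sum_div]
  refine tendsto_finsetSum _ fun i hi => ?_
  have hi0 : i ≠ 0 := (Finset.mem_filter.1 hi).2
  have hΔ : 0 < μ 0 - μ i := sub_pos.2 (hμ i hi0)
  have hN : Tendsto (fun n => (BatchedBandit.pullCount A i n ω : ℝ) / Real.log n) atTop
      (𝓝 (2 / (μ 0 - μ i) ^ 2)) := hω.tendsto_pathCount_div_log hμ hi0
  have hinf : Tendsto (fun n => BatchedBandit.pullCount A i n ω) atTop atTop :=
    hω.tendsto_pathCount i
  have hN1 : Tendsto (fun n => (1 + (BatchedBandit.pullCount A i n ω : ℝ)) / Real.log n) atTop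
      (𝓝 (2 / (μ 0 - μ i) ^ 2)) := by
    have h0 : Tendsto (fun n : ℕ => 1 / Real.log n) atTop (𝓝 0) :=
      BatchedBandit.tendsto_log_natCast.const_div_atTop 1
    simpa [add_div] using h0.add hN
  have key := (((((hsel i 0).2 hinf).sub ((hsel i i).2 hinf)).mul hN1).add
    (hN.const_mul (μ 0 - μ i)))
  have e : (0 - 0) * (2 / (μ 0 - μ i) ^ 2) + (μ 0 - μ i) * (2 / (μ 0 - μ i) ^ 2)
      = 2 / (μ 0 - μ i) := by
    field_simp
    ring
  rw [e] at key
  refine key.congr fun n => ?_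
  have : (1 + (BatchedBandit.pullCount A i n ω : ℝ)) ≠ 0 := by positivity
  rw [← sub_div, div_mul_div_cancel₀ this]
  ring
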